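/- Let $A=\mathbb C^{d_A}$ with $d_A\ge 1$ and $B=\mathbb C^{d_B}$. A non-commutative bipartite graph is a subspace $K$ of the linear maps $A\to B$ that is the linear span of the Choi--Kraus operators $E_k$ ($\sum_k E_k^\dagger E_k=\mathbb 1_A$) of some quantum channel $\mathcal N:\mathcal L(A)\to\mathcal L(B)$, $\mathcal N(\rho)=\sum_k E_k\rho E_k^\dagger$. Let $P=P_{AB}$ be the projection onto the support of the Choi--Jamiołkowski matrix $J_{AB}=\sum_{i,j}|i\rangle\langle j|\otimes\mathcal N(|i\rangle\langle j|)$, that is, onto $\{\sum_a |a\rangle\otimes E|a\rangle : E\in K\}$, so that $P$ depends only on $K$; put $P_B=\mathrm{tr}_A P_{AB}$, and let $\|\cdot\|_\infty$ be the operator norm. Define $$\Upsilon(K)=\max\{\mathrm{tr}\,S_A : 0\le U_{AB}\le S_A\otimes\mathbb 1_B,\ \mathrm{tr}_A U_{AB}=\mathbb 1_B,\ \mathrm{tr}\,P_{AB}(S_A\otimes\mathbb 1_B-U_{AB})=0\},$$ $$\widehat\Upsilon(K)=\max\{\mathrm{tr}\,S_A : 0\le U_{AB}\le S_A\otimes\mathbb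 1_B,\ \mathrm{tr}_A U_{AB}\le\mathbb 1_B,\ \mathrm{tr}\,P_{AB}(S_A\otimes\mathbb 1_B-U_{AB})=0\},$$ $$\mathsf A(K)=\max\{\mathrm{tr}\,S_A : S_A\ge 0,\ \mathrm{tr}_A P_{AB}(S_A\otimes\mathbb 1_B)\le\mathbb 1_B\},\qquad C_{0,\mathrm{NS}}(K)=\sup_{n\ge1}\tfrac1n\log_2\Upsilon(K^{\otimes n}).$$ Then the following are equivalent: (i) $C_{0,\mathrm{NS}}(K)>0$; (ii) $\mathsf A(K)>1$; (iii) $P_B<d_A\mathbb 1_B$, i.e. $d_A\mathbb 1_B-P_B$ is positive definite; (iv) $\mathrm{tr}_A(\mathbb 1_{AB}-P_{AB})$ is positive definite; (v) $\widehat\Upsilon(K)>1$. Moreover, $$C_{0,\mathrm{NS}}(K)\ \ge\ \log_2\widehat\Upsilon(K)\ \ge\ \log_2\frac{d_A}{\|P_B\|_\infty},\qquad \widehat\Upsilon(K)\ge\frac{d_A}{\|P_B\|_\infty},\qquad \mathsf A(K)\ge\frac{d_A}{\|P_B\|_\infty}.$$ Finally, $\frac{d_A}{\|P_B\|_\infty}=\mathsf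 A(K_s)$, where $K_s$ is the non-commutative bipartite graph of the cq-channel with $d_A^2$ inputs $m$ and output states $\frac1{d_A}(U_m\otimes\mathbb 1_B)J_{AB}(U_m\otimes\mathbb 1_B)^\dagger$, with $U_m$ the $d_A^2$ generalized Pauli matrices $X^jZ^k$ on $A$. -/

import Mathlib

open scoped Matrix Kronecker ComplexOrder

noncomputable section

namespace NoSignalling

variable {A B M : Type*} [Fintype A] [DecidableEq A] [Fintype B] [DecidableEq B]
  [DecidableEq M]

/-- The matrices `E k : A → B` are Choi-Kraus operators of a quantum channel
`ρ ↦ ∑ k, E k * ρ * (E k)ᴴ` from `L(A)` to `L(B)` (trace preservation; complete positivity is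
automatic). -/
def IsKrausFamily {κ : Type*} [Fintype κ] (E : κ → Matrix B A ℂ) : Prop :=
  ∑ k, (E k)ᴴ * E k = 1

/-- A non-commutative bipartite graph: the linear span of the Choi-Kraus operators of a quantum
channel. -/
def IsNCBipartiteGraph (K : Submodule ℂ (Matrix B A ℂ)) : Prop :=
  ∃ (r : ℕ) (E : Fin r → Matrix B A ℂ), IsKrausFamily E ∧
    K = Submodule.span ℂ (Set.range E)

/-- The linear map `E ↦ (𝟙 ⊗ E) ∑ a, |a⟩|a⟩`, i.e. `E ↦ ∑ a, |a⟩ ⊗ E|a⟩`, with values in the Hilbert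
space `A ⊗ B`. -/
def vecMap : Matrix B A ℂ →ₗ[ℂ] EuclideanSpace ℂ (A × B) where
  toFun E := WithLp.toLp 2 E.vec
  map_add' E F := by rw [Matrix.vec_add, WithLp.toLp_add]
  map_smul' c E := by rw [Matrix.vec_smul, WithLp.toLp_smul]; rfl

/-- The Choi-Jamiołkowski matrix `∑ i j, |i⟩⟨j| ⊗ N(|i⟩⟨j|)` of the channel `N` with Kraus
operators `E`. -/
def choiMatrix {κ : Type*} [Fintype κ] (E : κ → Matrix B A ℂ) : Matrix (A × B) (A × B) ℂ :=
  Matrix.of fun x y =>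
    (∑ k, E k * (Matrix.single x.1 y.1 1 : Matrix A A ℂ) * (E k)ᴴ : Matrix B B ℂ) x.2 y.2

/-- The Choi-Jamiołkowski projection `P_{AB}` of `K`: the orthogonal projection onto
`{(𝟙 ⊗ E) ∑ a, |a⟩|a⟩ : E ∈ K}`. By `range_choiMatrix` below this subspace is the support of the
Choi-Jamiołkowski matrix of every channel whose Choi-Kraus operators span `K`. -/
def choiProj (K : Submodule ℂ (Matrix B A ℂ)) : Matrix (A × B) (A × B) ℂ :=
  (Matrix.toEuclideanCLM (n := A × B) (𝕜 := ℂ)).symm (K.map vecMap).starProjection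

/-- The support (range) of the Choi-Jamiołkowski matrix depends only on the span of the Kraus
operators, and it is the subspace used in `choiProj`. -/
theorem range_choiMatrix {κ : Type*} [Fintype κ] [DecidableEq κ] (E : κ → Matrix B A ℂ) :
    (Matrix.toEuclideanLin (choiMatrix E)).range =
      (Submodule.span ℂ (Set.range E)).map vecMap := by
  let V : Matrix (A × B) κ ℂ := Matrix.of fun x k => (E k).vec x
  have h1 : choiMatrix E = V * Vᴴ := by
    ext x y
    simp [choiMatrix, V, Matrix.mul_apply, Matrix.sum_apply, Matrix.vec, Matrix.single_apply,
      ite_and]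
  have h2 : Matrix.toEuclideanLin (choiMatrix E) =
      Matrix.toEuclideanLin V ∘ₗ (Matrix.toEuclideanLin V).adjoint := by
    rw [h1, ← Matrix.toEuclideanLin_conjTranspose_eq_adjoint]
    ext x : 1
    simp [Matrix.toLpLin_apply]
  have h3 : ∀ x : EuclideanSpace ℂ κ,
      Matrix.toEuclideanLin V x = vecMap (∑ k, x k • E k) := by
    intro x
    ext y
    simp [Matrix.toLpLin_apply, Matrix.mulVec, dotProduct, V, vecMap, Matrix.vec,
      mul_comm]
  rw [h2, LinearMap.range_self_comp_adjoint]
  ext v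
  simp only [LinearMap.mem_range, Submodule.mem_map]
  constructor
  · rintro ⟨x, rfl⟩
    exact ⟨_, Submodule.sum_mem _ fun k _ => Submodule.smul_mem _ _
      (Submodule.subset_span ⟨k, rfl⟩), (h3 x).symm⟩
  · rintro ⟨F, hF, rfl⟩
    obtain ⟨c, rfl⟩ := (Submodule.mem_span_range_iff_exists_fun ℂ).1 hF
    exact ⟨WithLp.toLp 2 c, h3 _⟩

/-- The partial trace `tr_A`. -/
def trA (X : Matrix (A × B) (A × B) ℂ) : Matrix B B ℂ :=
  Matrix.of fun b b' => ∑ a, X (a, b) (a, b')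

/-- The operator norm `‖X‖_∞` (largest singular value). -/
def opNorm (X : Matrix B B ℂ) : ℝ := ‖Matrix.toEuclideanCLM (𝕜 := ℂ) X‖

/-- The tensor power `K^{⊗n}`: the span of all `E 0 ⊗ ⋯ ⊗ E (n - 1)` with `E i ∈ K`. -/
def tensorPow (K : Submodule ℂ (Matrix B A ℂ)) (n : ℕ) :
    Submodule ℂ (Matrix (Fin n → B) (Fin n → A) ℂ) :=
  Submodule.span ℂ {F | ∃ E : Fin n → Matrix B A ℂ, (∀ i, E i ∈ K) ∧
    F = Matrix.of fun b a => ∏ i, E i (b i) (a i)}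

/-- `Υ(K) = max tr S` subject to `0 ≤ U ≤ S ⊗ 𝟙`, `tr_A U = 𝟙`, `tr P (S ⊗ 𝟙 - U) = 0`. -/
def upsilon (K : Submodule ℂ (Matrix B A ℂ)) : ℝ :=
  sSup {t : ℝ | ∃ (S : Matrix A A ℂ) (U : Matrix (A × B) (A × B) ℂ),
    U.PosSemidef ∧ (S ⊗ₖ (1 : Matrix B B ℂ) - U).PosSemidef ∧
    trA U = 1 ∧
    (choiProj K * (S ⊗ₖ (1 : Matrix B B ℂ) - U)).trace = 0 ∧
    t = S.trace.re}

/-- `Υ̂(K) = max tr S` subject to `0 ≤ U ≤ S ⊗ 𝟙`, `tr_A U ≤ 𝟙`, `tr P (S ⊗ 𝟙 - U) = 0`. -/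
def upsilonHat (K : Submodule ℂ (Matrix B A ℂ)) : ℝ :=
  sSup {t : ℝ | ∃ (S : Matrix A A ℂ) (U : Matrix (A × B) (A × B) ℂ),
    U.PosSemidef ∧ (S ⊗ₖ (1 : Matrix B B ℂ) - U).PosSemidef ∧
    (1 - trA U).PosSemidef ∧
    (choiProj K * (S ⊗ₖ (1 : Matrix B B ℂ) - U)).trace = 0 ∧
    t = S.trace.re}

/-- The semidefinite (fractional) packing number
`A(K) = max tr S` subject to `0 ≤ S`, `tr_A P (S ⊗ 𝟙) ≤ 𝟙`. -/
def packing (K : Submodule ℂ (Matrix B A ℂ)) : ℝ :=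
  sSup {t : ℝ | ∃ S : Matrix A A ℂ, S.PosSemidef ∧
    (1 - trA (choiProj K * (S ⊗ₖ (1 : Matrix B B ℂ)))).PosSemidef ∧
    t = S.trace.re}

/-- The no-signalling assisted zero-error capacity
`C_{0,NS}(K) = sup_{n ≥ 1} (1/n) log₂ Υ(K^{⊗n})`. -/
def capacity (K : Submodule ℂ (Matrix B A ℂ)) : ℝ :=
  sSup {t : ℝ | ∃ n : ℕ, 1 ≤ n ∧ t = (1 / (n : ℝ)) * Real.logb 2 (upsilon (tensorPow K n))}

/-- The cq-graph of a cq-channel `|m⟩⟨m| ↦ ρ m` whose output states `ρ m` have supports `V m`: the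
span of the operators `|v⟩⟨m|` with `v ∈ V m`. -/
def cqGraph (V : M → Submodule ℂ (B → ℂ)) : Submodule ℂ (Matrix B M ℂ) :=
  Submodule.span ℂ {F | ∃ m, ∃ v ∈ V m, F = Matrix.vecMulVec v (Pi.single m 1)}

/-- The generalized Pauli matrices `X^j Z^k` on `ℂ^d`, where `X|a⟩ = |a + 1 mod d⟩` and
`Z|a⟩ = exp(2πi a / d)|a⟩`. -/
def pauli (d : ℕ) [NeZero d] (m : Fin d × Fin d) : Matrix (Fin d) (Fin d) ℂ :=
  Matrix.of fun a' a => if a' = a + m.1 then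
    Complex.exp (2 * Real.pi * Complex.I * ((m.2 : ℕ) : ℂ) * ((a : ℕ) : ℂ) / (d : ℂ)) else 0

/-- The cq-graph of the cq-channel obtained by super-dense coding. It has `d²` inputs `m` and
outputs `(U_m ⊗ 𝟙) J (U_m ⊗ 𝟙)ᴴ` on `A ⊗ B` (up to normalization), where `J` is the
Choi-Jamiołkowski matrix and `U_m` are the generalized Pauli matrices on `A`; the support of
output `m` is `(U_m ⊗ 𝟙)` applied to the support of `J`. -/
def superdenseGraph {d : ℕ} [NeZero d] (K : Submodule ℂ (Matrix B (Fin d) ℂ)) :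
    Submodule ℂ (Matrix (Fin d × B) (Fin d × Fin d) ℂ) :=
  cqGraph fun m => Submodule.span ℂ
    {v | ∃ E ∈ K, v = (pauli d m ⊗ₖ (1 : Matrix B B ℂ)) *ᵥ E.vec}

end NoSignalling

end

/-
Zero-error capacity of quantum channels assisted by no-signalling correlations: positivity and lower
bounds in terms of the Choi projection of a non-commutative bipartite graph.
-/

noncomputable section

namespace NoSignalling

open Matrix

set_option linter.unusedSectionVars false

/-! ### Positive semidefinite matrices, trace pairings and operator-norm bounds. -/

section Positivity

variable {I J : Type*} [Fintype I] [DecidableEq I] [Fintype J] [DecidableEq J]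

/-! Write `Q = 𝟙 - P`. Since `tr_A 𝟙 = d_A 𝟙`, conditions (iii) and (iv) concern the same matrix,
and everything turns on whether `tr_A Q` is singular.

If it is, a kernel vector gives a state `ω` with `P (𝟙 ⊗ ω) = 𝟙 ⊗ ω`. For feasible `(S, U)` the
constraint `tr P (S ⊗ 𝟙 - U) = 0` with `S ⊗ 𝟙 - U ≥ 0` forces `(S ⊗ 𝟙 - U) P = 0`, so `tr S = tr (𝟙
⊗ ω)(S ⊗ 𝟙) = tr ω (tr_A U) ≤ 1`. The powers of `ω` do the same for `K^{⊗n}`, and a similar pairing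
bounds the packing number, so none of the three quantities is nontrivial
(`exists_state_of_not_posDef`).

If `tr_A Q` is positive definite, then `‖P_B‖ < d_A`, and the choice `S = 𝟙 / ‖P_B‖`, `U = P /
‖P_B‖` shows that both `upsilonHat` and `packing` are at least `d_A / ‖P_B‖ > 1`.

The main point is `log₂ Υ̂ ≤ C_{0,NS}`: the inequality `tr_A U ≤ 𝟙` must be turned into an equality.
This is done with two extra copies of `K`, at the cost of a factor `C` in `tr S`
(`HatFeasible.exists_feasible_box`). The key object is a Hermitian `V` annihilated by `P ⊗ P` with
the same partial trace as `P ⊗ P` (`exists_trA_eq_trA_box`): a multiple of it, subtracted from the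
candidate for `U`, cancels the unwanted part of the partial trace. As `C` does not depend on `n`,
`Υ(K^{⊗(n+2)}) ≥ (tr S)^n / C`, and the loss vanishes in the rate.

For the superdense graph, the Pauli twirl of `P` is `d_A 𝟙 ⊗ P_B`, which makes the uniform input
weight optimal. -/

open scoped MatrixOrder in
theorem _root_.Matrix.PosSemidef.exists_eq_conjTranspose_mul_self {X : Matrix I I ℂ}
    (hX : X.PosSemidef) : ∃ Y : Matrix I I ℂ, X = Yᴴ * Y :=
  CStarAlgebra.nonneg_iff_eq_star_mul_self.1 hX.nonneg

theorem opNorm_nonneg (X : Matrix I I ℂ) : 0 ≤ opNorm X := norm_nonneg _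

section
open scoped MatrixOrder Matrix.Norms.L2Operator

theorem posSemidef_opNorm_smul_one_sub {X : Matrix I I ℂ} (hX : X.IsHermitian) :
    ((opNorm X : ℂ) • (1 : Matrix I I ℂ) - X).PosSemidef := by
  have h := IsSelfAdjoint.le_algebraMap_norm_self (a := X) hX
  rw [Matrix.le_iff] at h
  have e : (algebraMap ℝ (Matrix I I ℂ)) ‖X‖ = (opNorm X : ℂ) • (1 : Matrix I I ℂ) := by
    ext i j
    simp [Algebra.algebraMap_eq_smul_one, opNorm, Matrix.l2_opNorm_def]
    exact Or.inl rfl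
  rwa [e] at h

theorem opNorm_le_of_posSemidef {X : Matrix I I ℂ} (hX : X.PosSemidef) {r : ℝ} (hr : 0 ≤ r)
    (h : ((r : ℂ) • (1 : Matrix I I ℂ) - X).PosSemidef) : opNorm X ≤ r := by
  refine (CStarAlgebra.norm_le_iff_le_algebraMap X hr hX.nonneg).2 ?_
  rw [Matrix.le_iff]
  have e : (algebraMap ℝ (Matrix I I ℂ)) r = (r : ℂ) • (1 : Matrix I I ℂ) := by
    ext i j
    simp [Algebra.algebraMap_eq_smul_one]
  rwa [e]

end

theorem opNorm_eq_zero {X : Matrix I I ℂ} : opNorm X = 0 ↔ X = 0 := by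
  simp [opNorm]

theorem exists_posSemidef_smul_one_sub_add {X : Matrix I I ℂ} (hX : X.IsHermitian) :
    ∃ C : ℝ, 0 < C ∧ ((C : ℂ) • (1 : Matrix I I ℂ) - X).PosSemidef ∧
      ((C : ℂ) • (1 : Matrix I I ℂ) + X).PosSemidef := by
  have key : ∀ Y : Matrix I I ℂ, Y.IsHermitian → opNorm Y ≤ opNorm X →
      (((opNorm X + 1 : ℝ) : ℂ) • (1 : Matrix I I ℂ) - Y).PosSemidef := by
    intro Y hY hle
    have h0 : (0 : ℂ) ≤ ((opNorm X + 1 - opNorm Y : ℝ) : ℂ) := by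
      exact_mod_cast (by linarith)
    have := (posSemidef_opNorm_smul_one_sub hY).add
      ((PosSemidef.one (n := I) (R := ℂ)).smul h0)
    convert this using 1
    push_cast
    module
  -- The summand 1 keeps the constant positive when `X = 0`.
  refine ⟨opNorm X + 1, by linarith [opNorm_nonneg X], key X hX le_rfl, ?_⟩
  have h := key (-X) hX.neg (by simp [opNorm])
  rwa [sub_neg_eq_add] at h

/-- The trace pairing of positive semidefinite matrices is nonnegative. -/
theorem trace_mul_nonneg {X Y : Matrix I I ℂ} (hX : X.PosSemidef) (hY : Y.PosSemidef) :
    0 ≤ (X * Y).trace := by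
  obtain ⟨Z, rfl⟩ := hX.exists_eq_conjTranspose_mul_self
  rw [Matrix.mul_assoc, trace_mul_comm]
  exact (hY.mul_mul_conjTranspose_same Z).trace_nonneg

theorem trace_mul_le {X Y Z : Matrix I I ℂ} (hX : X.PosSemidef) (hY : (Z - Y).PosSemidef) :
    (X * Y).trace ≤ (X * Z).trace := by
  have := trace_mul_nonneg hX hY
  rwa [Matrix.mul_sub, trace_sub, sub_nonneg] at this

/-- If `P` is a projection and `D ≥ 0` satisfies `tr (P D) = 0`, then `D P = 0`. -/
theorem mul_eq_zero_of_trace_eq_zero {P D : Matrix I I ℂ} (hP : P.IsHermitian) (hPP : P * P = P)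
    (hD : D.PosSemidef) (h : (P * D).trace = 0) : D * P = 0 := by
  obtain ⟨Y, rfl⟩ := hD.exists_eq_conjTranspose_mul_self
  -- With `D = Yᴴ Y`, the squared Hilbert–Schmidt norm of `Y P` is `tr (P D)`, so `Y P = 0`.
  have h1 : ((Y * P)ᴴ * (Y * P)).trace = 0 := by
    rw [conjTranspose_mul, hP.eq, trace_mul_comm, ← h, trace_mul_comm P]
    calc (Y * P * (P * Yᴴ)).trace = (Y * (P * P) * Yᴴ).trace := by simp only [Matrix.mul_assoc]
      _ = _ := by rw [hPP, Matrix.mul_assoc, trace_mul_comm, Matrix.mul_assoc, trace_mul_comm]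
  rw [trace_conjTranspose_mul_self_eq_zero_iff] at h1
  rw [Matrix.mul_assoc, h1, Matrix.mul_zero]

theorem trace_mul_eq_zero_of_supported {P D X : Matrix I I ℂ} (hP : P.IsHermitian)
    (hPP : P * P = P) (hD : D.PosSemidef) (h : (P * D).trace = 0) (hX : P * X = X) :
    (X * D).trace = 0 := by
  rw [trace_mul_comm, ← hX, ← Matrix.mul_assoc, mul_eq_zero_of_trace_eq_zero hP hPP hD h,
    Matrix.zero_mul, trace_zero]

theorem posSemidef_of_isHermitian_of_mul_self {P : Matrix I I ℂ} (hP : P.IsHermitian)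
    (hPP : P * P = P) : P.PosSemidef := by
  have := posSemidef_conjTranspose_mul_self P
  rwa [hP.eq, hPP] at this

theorem _root_.Matrix.IsHermitian.coe_re_trace {X : Matrix I I ℂ} (hX : X.IsHermitian) :
    ((X.trace.re : ℝ) : ℂ) = X.trace := by
  apply Complex.conj_eq_iff_re.1
  have := congrArg trace hX.eq
  rwa [trace_conjTranspose] at this

end Positivity

/-! ### The partial trace over `A`. -/

section PartialTrace

variable {A B : Type*} [Fintype A] [DecidableEq A] [Fintype B] [DecidableEq B]

theorem trA_add (X Y : Matrix (A × B) (A × B) ℂ) : trA (X + Y) = trA X + trA Y := by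
  ext; simp [trA, Finset.sum_add_distrib]

theorem trA_sub (X Y : Matrix (A × B) (A × B) ℂ) : trA (X - Y) = trA X - trA Y := by
  ext; simp [trA]

theorem trA_smul (c : ℂ) (X : Matrix (A × B) (A × B) ℂ) : trA (c • X) = c • trA X := by
  ext; simp [trA, Finset.mul_sum]

theorem trA_kronecker (S : Matrix A A ℂ) (T : Matrix B B ℂ) :
    trA (S ⊗ₖ T) = S.trace • T := by
  ext; simp [trA, trace, Finset.sum_mul]

theorem trA_one : trA (1 : Matrix (A × B) (A × B) ℂ) = (Fintype.card A : ℂ) • 1 := by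
  rw [← one_kronecker_one, trA_kronecker, trace_one]

theorem trA_conjTranspose (X : Matrix (A × B) (A × B) ℂ) : trA Xᴴ = (trA X)ᴴ := by
  ext; simp [trA]

theorem trace_trA (X : Matrix (A × B) (A × B) ℂ) : (trA X).trace = X.trace := by
  simp [trA, trace, Fintype.sum_prod_type_right]

theorem trA_mul_one_kronecker (X : Matrix (A × B) (A × B) ℂ) (T : Matrix B B ℂ) :
    trA (X * ((1 : Matrix A A ℂ) ⊗ₖ T)) = trA X * T := by
  ext b b'
  simp only [trA, of_apply, mul_apply, Fintype.sum_prod_type, kronecker_apply, one_apply,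
    Finset.sum_mul, ite_mul, one_mul, zero_mul, mul_ite, mul_zero]
  rw [Finset.sum_comm (s := (Finset.univ : Finset B))]
  refine Finset.sum_congr rfl fun a _ => ?_
  rw [Finset.sum_comm]
  simp

theorem trA_one_kronecker_mul (X : Matrix (A × B) (A × B) ℂ) (T : Matrix B B ℂ) :
    trA (((1 : Matrix A A ℂ) ⊗ₖ T) * X) = T * trA X := by
  have := congrArg conjTranspose (trA_mul_one_kronecker Xᴴ Tᴴ)
  simpa [← trA_conjTranspose, conjTranspose_mul, conjTranspose_kronecker] using this

/-- Cyclicity of the trace in the factor that is traced out; it makes unitary conjugation on `A`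
invisible to `trA`. -/
theorem trA_kronecker_one_mul_comm (X : Matrix (A × B) (A × B) ℂ) (S : Matrix A A ℂ) :
    trA (X * (S ⊗ₖ (1 : Matrix B B ℂ))) = trA ((S ⊗ₖ (1 : Matrix B B ℂ)) * X) := by
  ext b b'
  simp only [trA, of_apply, mul_apply, Fintype.sum_prod_type, kronecker_apply, one_apply,
    ite_mul, zero_mul, mul_ite, mul_zero, mul_one, Finset.sum_ite_eq, Finset.sum_ite_eq',
    Finset.mem_univ, if_true]
  rw [Finset.sum_comm]
  simp only [mul_comm]

theorem trA_posSemidef {X : Matrix (A × B) (A × B) ℂ} (hX : X.PosSemidef) :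
    (trA X).PosSemidef := by
  have : trA X = ∑ a, X.submatrix (fun b => (a, b)) (fun b => (a, b)) := by
    ext; simp [trA, Matrix.sum_apply]
  rw [this]
  exact posSemidef_sum _ fun a _ => hX.submatrix _

end PartialTrace

/-! ### Tensor products of two bipartite operators. -/

section Box

variable {A B A' B' : Type*} [Fintype A'] [DecidableEq A'] [Fintype B'] [DecidableEq B']
  [Fintype A] [DecidableEq A] [Fintype B] [DecidableEq B]

/-- The tensor product of two operators on bipartite spaces, regrouped as an operator on the
bipartite space `(A ⊗ A') ⊗ (B ⊗ B')`. -/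
def box (X : Matrix (A × B) (A × B) ℂ) (Y : Matrix (A' × B') (A' × B') ℂ) :
    Matrix ((A × A') × (B × B')) ((A × A') × (B × B')) ℂ :=
  (X ⊗ₖ Y).submatrix (Equiv.prodProdProdComm A A' B B') (Equiv.prodProdProdComm A A' B B')

variable (X X₁ X₂ : Matrix (A × B) (A × B) ℂ) (Y Y₁ Y₂ : Matrix (A' × B') (A' × B') ℂ)

theorem box_mul : box (X₁ * X₂) (Y₁ * Y₂) = box X₁ Y₁ * box X₂ Y₂ := by
  rw [box, mul_kronecker_mul, box, box, submatrix_mul_equiv]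

theorem box_add_right : box X (Y₁ + Y₂) = box X Y₁ + box X Y₂ := by
  ext; simp [box, mul_add]

theorem box_sub_left : box (X₁ - X₂) Y = box X₁ Y - box X₂ Y := by
  ext; simp [box, sub_mul]

theorem box_sub_right : box X (Y₁ - Y₂) = box X Y₁ - box X Y₂ := by
  ext; simp [box, mul_sub]

theorem box_smul_right (c : ℂ) : box X (c • Y) = c • box X Y := by
  ext; simp [box, mul_left_comm]

theorem box_zero_right : box X (0 : Matrix (A' × B') (A' × B') ℂ) = 0 := by
  ext; simp [box]

theorem box_zero_left : box (0 : Matrix (A × B) (A × B) ℂ) Y = 0 := by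
  ext; simp [box]

theorem box_conjTranspose : (box X Y)ᴴ = box Xᴴ Yᴴ := by
  ext; simp [box]

theorem box_kronecker (S : Matrix A A ℂ) (T : Matrix B B ℂ) (S' : Matrix A' A' ℂ)
    (T' : Matrix B' B' ℂ) : box (S ⊗ₖ T) (S' ⊗ₖ T') = (S ⊗ₖ S') ⊗ₖ (T ⊗ₖ T') := by
  ext; simp [box, mul_mul_mul_comm]

theorem trace_box : (box X Y).trace = X.trace * Y.trace := by
  rw [← trace_kronecker, box, trace, trace]
  exact Equiv.sum_comp (Equiv.prodProdProdComm A A' B B') fun i => (X ⊗ₖ Y) i i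

theorem trA_box : trA (box X Y) = trA X ⊗ₖ trA Y := by
  ext
  simp [trA, box, Fintype.sum_prod_type, Finset.sum_mul_sum]

variable {X Y}

theorem box_posSemidef (hX : X.PosSemidef) (hY : Y.PosSemidef) : (box X Y).PosSemidef :=
  (hX.kronecker hY).submatrix _

end Box

/-! ### Tensor powers of matrices and of bipartite operators. -/

section TensorPower

variable {ι I A B : Type*} [Fintype ι] [DecidableEq ι] [Fintype I] [DecidableEq I]
  [Fintype A] [DecidableEq A] [Fintype B] [DecidableEq B]

/-- The tensor product of a family of square matrices. -/
def tprod (f : ι → Matrix I I ℂ) : Matrix (ι → I) (ι → I) ℂ :=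
  Matrix.of fun x y => ∏ i, f i (x i) (y i)

theorem tprod_mul (f g : ι → Matrix I I ℂ) :
    tprod (fun i => f i * g i) = tprod f * tprod g := by
  ext x y
  simp [tprod, mul_apply, Finset.prod_univ_sum, Finset.prod_mul_distrib]

theorem tprod_conjTranspose (f : ι → Matrix I I ℂ) : (tprod f)ᴴ = tprod fun i => (f i)ᴴ := by
  ext x y
  simp [tprod]

theorem tprod_one : tprod (fun _ : ι => (1 : Matrix I I ℂ)) = 1 := by
  ext x y
  simp [tprod, one_apply, Finset.prod_ite_zero, funext_iff]

theorem tprod_smul (c : ℂ) (X : Matrix I I ℂ) :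
    tprod (fun _ : ι => c • X) = c ^ Fintype.card ι • tprod fun _ => X := by
  ext x y
  simp [tprod, Finset.prod_mul_distrib]

theorem trace_tprod (f : ι → Matrix I I ℂ) : (tprod f).trace = ∏ i, (f i).trace := by
  simp [tprod, trace, Finset.prod_univ_sum]

theorem tprod_posSemidef {f : ι → Matrix I I ℂ} (hf : ∀ i, (f i).PosSemidef) :
    (tprod f).PosSemidef := by
  choose Y hY using fun i => (hf i).exists_eq_conjTranspose_mul_self
  have : tprod f = (tprod Y)ᴴ * tprod Y := by
    rw [tprod_conjTranspose, ← tprod_mul]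
    exact congrArg tprod (funext hY)
  rw [this]
  exact posSemidef_conjTranspose_mul_self _

/-- Tensor powers are monotone on positive semidefinite matrices. -/
theorem tprod_sub_posSemidef {X Y : Matrix I I ℂ} (hY : Y.PosSemidef)
    (h : (X - Y).PosSemidef) :
    ((tprod fun _ : ι => X) - tprod fun _ : ι => Y).PosSemidef := by
  -- Expand the product after writing `X = Y + (X - Y)` in each factor; the term with `Y` everywhere
  -- is removed, and every remaining term is a tensor product of positive semidefinite matrices.
  have key : (tprod fun _ : ι => X) - (tprod fun _ : ι => Y) =
      ∑ t ∈ (Finset.univ : Finset ι).powerset.erase Finset.univ,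
        tprod fun i => if i ∈ t then Y else X - Y := by
    rw [sub_eq_iff_eq_add]
    have h1 : (tprod fun _ : ι => Y) = tprod fun i => if i ∈ Finset.univ then Y else X - Y := by
      simp
    rw [h1, Finset.sum_erase_add _ _ (by simp)]
    ext x y
    simp only [tprod, of_apply, Matrix.sum_apply]
    have h2 : ∀ i, X (x i) (y i) = Y (x i) (y i) + (X - Y) (x i) (y i) := by simp
    simp_rw [h2]
    rw [Finset.prod_add]
    refine Finset.sum_congr rfl fun t ht => ?_
    rw [← Finset.prod_sdiff (Finset.subset_univ t), mul_comm]
    congr 1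
    · refine Finset.prod_congr rfl fun i hi => ?_
      rw [if_neg (Finset.mem_sdiff.1 hi).2]
    · refine Finset.prod_congr rfl fun i hi => ?_
      rw [if_pos hi]
  rw [key]
  refine posSemidef_sum _ fun t _ => tprod_posSemidef fun i => ?_
  split_ifs
  exacts [hY, h]

/-- The tensor power of a bipartite operator, as a bipartite operator. -/
def biPow (ι : Type*) [Fintype ι] (X : Matrix (A × B) (A × B) ℂ) :
    Matrix ((ι → A) × (ι → B)) ((ι → A) × (ι → B)) ℂ :=
  (tprod fun _ : ι => X).submatrix (Equiv.arrowProdEquivProdArrow ι (fun _ => A) (fun _ => B)).symm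
    (Equiv.arrowProdEquivProdArrow ι (fun _ => A) (fun _ => B)).symm

theorem biPow_apply (X : Matrix (A × B) (A × B) ℂ) (x y : (ι → A) × (ι → B)) :
    biPow ι X x y = ∏ i, X (x.1 i, x.2 i) (y.1 i, y.2 i) := rfl

theorem biPow_mul (X Y : Matrix (A × B) (A × B) ℂ) : biPow ι (X * Y) = biPow ι X * biPow ι Y := by
  rw [biPow, tprod_mul, biPow, biPow, submatrix_mul_equiv]

theorem biPow_one : biPow ι (1 : Matrix (A × B) (A × B) ℂ) = 1 := by
  rw [biPow, tprod_one, submatrix_one_equiv]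

theorem biPow_smul (c : ℂ) (X : Matrix (A × B) (A × B) ℂ) :
    biPow ι (c • X) = c ^ Fintype.card ι • biPow ι X := by
  rw [biPow, tprod_smul]; rfl

theorem biPow_isHermitian {X : Matrix (A × B) (A × B) ℂ} (hX : X.IsHermitian) :
    (biPow ι X).IsHermitian := by
  refine IsHermitian.submatrix ?_ _
  rw [IsHermitian, tprod_conjTranspose, hX.eq]

theorem biPow_posSemidef {X : Matrix (A × B) (A × B) ℂ} (hX : X.PosSemidef) :
    (biPow ι X).PosSemidef :=
  (tprod_posSemidef fun _ => hX).submatrix _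

theorem biPow_sub_posSemidef {X Y : Matrix (A × B) (A × B) ℂ} (hY : Y.PosSemidef)
    (h : (X - Y).PosSemidef) : (biPow ι X - biPow ι Y).PosSemidef :=
  (tprod_sub_posSemidef hY h).submatrix _

theorem trace_biPow (X : Matrix (A × B) (A × B) ℂ) :
    (biPow ι X).trace = X.trace ^ Fintype.card ι := by
  have h : (biPow ι X).trace = (tprod fun _ : ι => X).trace :=
    Equiv.sum_comp (Equiv.arrowProdEquivProdArrow ι (fun _ => A) (fun _ => B)).symm
      fun i => tprod (fun _ : ι => X) i i
  rw [h, trace_tprod]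
  simp

theorem biPow_kronecker (S : Matrix A A ℂ) (T : Matrix B B ℂ) :
    biPow ι (S ⊗ₖ T) = (tprod fun _ => S) ⊗ₖ tprod fun _ => T := by
  ext
  simp [biPow_apply, tprod, Finset.prod_mul_distrib]

theorem trA_biPow (X : Matrix (A × B) (A × B) ℂ) : trA (biPow ι X) = tprod fun _ => trA X := by
  ext
  simp [trA, biPow_apply, tprod, Finset.prod_univ_sum]

end TensorPower

/-! ### The Choi projection: characterization and multiplicativity. -/

section ChoiProj

variable {A B : Type*} [Fintype A] [DecidableEq A] [Fintype B] [DecidableEq B]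
  {K : Submodule ℂ (Matrix B A ℂ)}

theorem choiProj_mulVec (K : Submodule ℂ (Matrix B A ℂ)) (v : A × B → ℂ) :
    WithLp.toLp 2 (choiProj K *ᵥ v) = (K.map vecMap).starProjection (WithLp.toLp 2 v) := by
  rw [← Matrix.toEuclideanCLM_toLp, choiProj, StarAlgEquiv.apply_symm_apply]

theorem choiProj_isHermitian (K : Submodule ℂ (Matrix B A ℂ)) : (choiProj K).IsHermitian := by
  rw [← isSymmetric_toEuclideanLin_iff]
  have h : ∀ v, toEuclideanLin (choiProj K) v = (K.map vecMap).starProjection v :=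
    fun v => choiProj_mulVec K v.ofLp
  intro v w
  rw [h, h]
  exact Submodule.inner_starProjection_left_eq_right _ v w

theorem choiProj_mulVec_vec {F : Matrix B A ℂ} (hF : F ∈ K) : choiProj K *ᵥ F.vec = F.vec := by
  have h := choiProj_mulVec K F.vec
  have hmem : WithLp.toLp 2 F.vec ∈ K.map vecMap := ⟨F, hF, rfl⟩
  rw [Submodule.starProjection_eq_self_iff.2 hmem] at h
  exact WithLp.toLp_injective 2 h

theorem exists_mem_vec_eq_choiProj_mulVec (K : Submodule ℂ (Matrix B A ℂ)) (v : A × B → ℂ) :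
    ∃ F ∈ K, F.vec = choiProj K *ᵥ v := by
  obtain ⟨F, hF, h⟩ := Submodule.starProjection_apply_mem (K.map vecMap) (WithLp.toLp 2 v)
  refine ⟨F, hF, WithLp.toLp_injective 2 ?_⟩
  rw [choiProj_mulVec, ← h]
  rfl

theorem mul_eq_self_of_col {P X : Matrix (A × B) (A × B) ℂ}
    (hP : ∀ F ∈ K, P *ᵥ F.vec = F.vec) (hX : ∀ y, ∃ F ∈ K, F.vec = X.col y) : P * X = X := by
  ext x y
  obtain ⟨F, hF, h⟩ := hX y
  have := congrFun (hP F hF) x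
  rw [h] at this
  simpa [mul_apply, mulVec, dotProduct] using this

theorem choiProj_mul_of_col {X : Matrix (A × B) (A × B) ℂ}
    (hX : ∀ y, ∃ F ∈ K, F.vec = X.col y) : choiProj K * X = X :=
  mul_eq_self_of_col (fun _ => choiProj_mulVec_vec) hX

theorem exists_mem_vec_eq_choiProj_col (K : Submodule ℂ (Matrix B A ℂ)) (y : A × B) :
    ∃ F ∈ K, F.vec = (choiProj K).col y := by
  obtain ⟨F, hF, h⟩ := exists_mem_vec_eq_choiProj_mulVec K (Pi.single y 1)
  exact ⟨F, hF, by rw [h, mulVec_single_one]⟩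

theorem choiProj_mul_self (K : Submodule ℂ (Matrix B A ℂ)) :
    choiProj K * choiProj K = choiProj K :=
  choiProj_mul_of_col (exists_mem_vec_eq_choiProj_col K)

/-- The Choi projection is the only Hermitian matrix which fixes the vectors of `K` and whose
columns are vectors of `K`. -/
theorem choiProj_eq {P : Matrix (A × B) (A × B) ℂ} (hP : P.IsHermitian)
    (hfix : ∀ F ∈ K, P *ᵥ F.vec = F.vec) (hcol : ∀ y, ∃ F ∈ K, F.vec = P.col y) :
    choiProj K = P := by
  have h1 : choiProj K * P = P := choiProj_mul_of_col hcol
  have h2 : P * choiProj K = choiProj K :=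
    mul_eq_self_of_col hfix (exists_mem_vec_eq_choiProj_col K)
  have h3 := congrArg conjTranspose h1
  rw [conjTranspose_mul, hP.eq, (choiProj_isHermitian K).eq, h2] at h3
  exact h3

theorem choiProj_posSemidef (K : Submodule ℂ (Matrix B A ℂ)) : (choiProj K).PosSemidef :=
  posSemidef_of_isHermitian_of_mul_self (choiProj_isHermitian K) (choiProj_mul_self K)

theorem one_sub_choiProj_posSemidef (K : Submodule ℂ (Matrix B A ℂ)) :
    (1 - choiProj K).PosSemidef := by
  refine posSemidef_of_isHermitian_of_mul_self
    (isHermitian_one.sub (choiProj_isHermitian K)) ?_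
  simp [Matrix.sub_mul, Matrix.mul_sub, choiProj_mul_self]

/-- By `choiProj_eq` it is enough that `P^{⊗n}` fixes the product vectors spanning the tensor power,
and that its columns, being products of columns of `P`, lie in that span. -/
theorem choiProj_tensorPow (K : Submodule ℂ (Matrix B A ℂ)) (n : ℕ) :
    choiProj (tensorPow K n) = biPow (Fin n) (choiProj K) := by
  refine choiProj_eq (biPow_isHermitian (choiProj_isHermitian K)) (fun F hF => ?_) fun y => ?_
  · induction hF using Submodule.span_induction with
    | mem F hF =>
      obtain ⟨E, hE, rfl⟩ := hF
      ext x
      have h : ∀ i, ∑ z, choiProj K (x.1 i, x.2 i) z * (E i).vec z = E i (x.2 i) (x.1 i) :=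
        fun i => congrFun (choiProj_mulVec_vec (hE i)) (x.1 i, x.2 i)
      simp only [vec, of_apply, ← h, Finset.prod_univ_sum, mulVec, dotProduct, biPow_apply,
        Fintype.piFinset_univ, ← Finset.prod_mul_distrib]
      exact Equiv.sum_comp
        (Equiv.arrowProdEquivProdArrow (Fin n) (fun _ => A) (fun _ => B)).symm
        fun z => ∏ i, choiProj K (x.1 i, x.2 i) (z i) * E i (z i).2 (z i).1
    | zero => simp
    | add F G _ _ hF hG => rw [vec_add, mulVec_add, hF, hG]
    | smul c F _ hF => rw [vec_smul, mulVec_smul, hF]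
  · choose E hE h using fun i => exists_mem_vec_eq_choiProj_col K (y.1 i, y.2 i)
    refine ⟨_, Submodule.subset_span ⟨E, hE, rfl⟩, ?_⟩
    ext x
    simp only [vec, of_apply, col_apply, biPow_apply]
    exact Finset.prod_congr rfl fun i _ => congrFun (h i) (x.1 i, x.2 i)

end ChoiProj

/-! ### Feasible points and upper bounds on their values. -/

section Feasible

variable {A B : Type*} [Fintype A] [DecidableEq A] [Fintype B] [DecidableEq B]

/-- The pair `(S, U)` is feasible for the program defining `upsilonHat`, with Choi projection
`P`. -/
structure HatFeasible (P : Matrix (A × B) (A × B) ℂ) (S : Matrix A A ℂ)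
    (U : Matrix (A × B) (A × B) ℂ) : Prop where
  nonneg : U.PosSemidef
  le : (S ⊗ₖ (1 : Matrix B B ℂ) - U).PosSemidef
  trA_le : (1 - trA U).PosSemidef
  trace_eq : (P * (S ⊗ₖ (1 : Matrix B B ℂ) - U)).trace = 0

/-- The matrix `S` is feasible for the program defining `packing`, with Choi projection `P`. -/
structure PackingFeasible (P : Matrix (A × B) (A × B) ℂ) (S : Matrix A A ℂ) : Prop where
  nonneg : S.PosSemidef
  trA_le : (1 - trA (P * (S ⊗ₖ (1 : Matrix B B ℂ)))).PosSemidef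

variable {P U : Matrix (A × B) (A × B) ℂ} {S : Matrix A A ℂ}

theorem HatFeasible.kronecker_posSemidef (h : HatFeasible P S U) :
    (S ⊗ₖ (1 : Matrix B B ℂ)).PosSemidef := by
  have := h.le.add h.nonneg
  rwa [sub_add_cancel] at this

theorem HatFeasible.posSemidef [Nonempty B] (h : HatFeasible P S U) : S.PosSemidef := by
  obtain ⟨b⟩ := ‹Nonempty B›
  have := h.kronecker_posSemidef.submatrix fun a => (a, b)
  convert this
  ext
  simp

/-- Tensor powers of feasible pairs are feasible. -/
theorem HatFeasible.biPow {ι : Type*} [Fintype ι] [DecidableEq ι] (h : HatFeasible P S U) :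
    HatFeasible (biPow ι P) (tprod fun _ => S) (biPow ι U) where
  nonneg := biPow_posSemidef h.nonneg
  le := by
    have := biPow_sub_posSemidef (ι := ι) h.nonneg h.le
    rwa [biPow_kronecker, tprod_one] at this
  trA_le := by
    have := tprod_sub_posSemidef (ι := ι) (trA_posSemidef h.nonneg) h.trA_le
    rwa [tprod_one, ← trA_biPow] at this
  trace_eq := by
    -- The constraint says `tr P (S ⊗ 𝟙) = tr P U`; for tensor powers both sides are raised to the
    -- same power.
    have h1 := h.trace_eq
    rw [Matrix.mul_sub, trace_sub, sub_eq_zero] at h1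
    rw [← tprod_one, ← biPow_kronecker, Matrix.mul_sub, ← biPow_mul, ← biPow_mul, trace_sub,
      trace_biPow, trace_biPow, h1, sub_self]

/-- An operator `X ≥ 0` supported in the range of `P` does not see the difference between
`S ⊗ 𝟙` and `U`. -/
theorem HatFeasible.trace_mul_kronecker (h : HatFeasible P S U) (hP : P.IsHermitian)
    (hPP : P * P = P) {X : Matrix (A × B) (A × B) ℂ} (hX : P * X = X) :
    (X * (S ⊗ₖ (1 : Matrix B B ℂ))).trace = (X * U).trace := by
  have := trace_mul_eq_zero_of_supported hP hPP h.le h.trace_eq hX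
  rwa [Matrix.mul_sub, trace_sub, sub_eq_zero] at this

theorem HatFeasible.trace_le (h : HatFeasible P S U) : U.trace ≤ Fintype.card B := by
  have := h.trA_le.trace_nonneg
  rwa [trace_sub, trace_trA, trace_one, sub_nonneg] at this

theorem trace_smul_one_mul_le {X Y : Matrix (A × B) (A × B) ℂ} {C : ℝ} (hY : Y.PosSemidef)
    (hX : ((C : ℂ) • 1 - X).PosSemidef) : (X * Y).trace ≤ C * Y.trace := by
  have := trace_mul_le hY hX
  rwa [Matrix.mul_smul, Matrix.mul_one, trace_smul, smul_eq_mul, trace_mul_comm] at this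

/-- For `J` the Choi matrix of a channel, `tr S = tr J (S ⊗ 𝟙) = tr J U ≤ C tr U ≤ C d_B`. This
gives the boundedness without which the suprema would be meaningless. -/
theorem HatFeasible.trace_re_le (h : HatFeasible P S U) (hP : P.IsHermitian) (hPP : P * P = P)
    {J : Matrix (A × B) (A × B) ℂ} (hJ : P * J = J)
    (htr : (J * (S ⊗ₖ (1 : Matrix B B ℂ))).trace = S.trace) {C : ℝ} (hC : 0 ≤ C)
    (hJC : ((C : ℂ) • 1 - J).PosSemidef) : S.trace.re ≤ C * Fintype.card B := by
  have h1 : S.trace ≤ C * Fintype.card B := by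
    rw [← htr, h.trace_mul_kronecker hP hPP hJ]
    exact (trace_smul_one_mul_le h.nonneg hJC).trans
      (mul_le_mul_of_nonneg_left h.trace_le (by exact_mod_cast hC))
  have h2 := (Complex.le_def.1 h1).1
  simpa using h2

/-- Compressing `J ≤ C 𝟙` to the range of `P` gives `J ≤ C P`, hence `tr S = tr J (S ⊗ 𝟙) ≤ C tr P
(S ⊗ 𝟙) ≤ C d_B`. -/
theorem PackingFeasible.trace_re_le (h : PackingFeasible P S) (hP : P.IsHermitian)
    (hPP : P * P = P) {J : Matrix (A × B) (A × B) ℂ} (hJ : P * J = J) (hJh : J.IsHermitian)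
    (htr : (J * (S ⊗ₖ (1 : Matrix B B ℂ))).trace = S.trace) {C : ℝ} (hC : 0 ≤ C)
    (hJC : ((C : ℂ) • 1 - J).PosSemidef) : S.trace.re ≤ C * Fintype.card B := by
  have hJP : J * P = J := by
    have := congrArg conjTranspose hJ
    rwa [conjTranspose_mul, hP.eq, hJh.eq] at this
  have h3 : ((C : ℂ) • P - J).PosSemidef := by
    have := hJC.conjTranspose_mul_mul_same P
    rwa [hP.eq, Matrix.mul_sub, Matrix.mul_smul, Matrix.mul_one, Matrix.sub_mul, Matrix.smul_mul,
      hPP, hJ, hJP] at this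
  have h4 : (P * (S ⊗ₖ (1 : Matrix B B ℂ))).trace ≤ Fintype.card B := by
    have := h.trA_le.trace_nonneg
    rwa [trace_sub, trace_trA, trace_one, sub_nonneg] at this
  have h1 : S.trace ≤ C * Fintype.card B := by
    rw [← htr, trace_mul_comm]
    refine (trace_mul_le (h.nonneg.kronecker PosSemidef.one) h3).trans ?_
    rw [Matrix.mul_smul, trace_smul, smul_eq_mul, trace_mul_comm]
    exact mul_le_mul_of_nonneg_left h4 (by exact_mod_cast hC)
  have h2 := (Complex.le_def.1 h1).1
  simpa using h2

/-- If `A ⊗ supp ω` lies in the range of `P` for some state `ω`, then `tr S ≤ 1`. -/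
theorem HatFeasible.trace_re_le_one (h : HatFeasible P S U) (hP : P.IsHermitian)
    (hPP : P * P = P) {ω : Matrix B B ℂ} (hω : ω.PosSemidef) (htr : ω.trace = 1)
    (hPω : P * ((1 : Matrix A A ℂ) ⊗ₖ ω) = (1 : Matrix A A ℂ) ⊗ₖ ω) : S.trace.re ≤ 1 := by
  have h1 : S.trace ≤ 1 := by
    have e := h.trace_mul_kronecker hP hPP hPω
    rw [← mul_kronecker_mul, Matrix.one_mul, Matrix.mul_one, trace_kronecker, htr, mul_one] at e
    rw [e, ← trace_trA, trA_one_kronecker_mul]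
    have := trace_mul_le hω h.trA_le
    rwa [Matrix.mul_one, htr] at this
  exact (Complex.le_def.1 h1).1

theorem PackingFeasible.trace_re_le_one (h : PackingFeasible P S) (hP : P.IsHermitian)
    {ω : Matrix B B ℂ} (hω : ω.PosSemidef) (htr : ω.trace = 1)
    (hPω : P * ((1 : Matrix A A ℂ) ⊗ₖ ω) = (1 : Matrix A A ℂ) ⊗ₖ ω) : S.trace.re ≤ 1 := by
  have hωP : ((1 : Matrix A A ℂ) ⊗ₖ ω) * P = (1 : Matrix A A ℂ) ⊗ₖ ω := by
    have := congrArg conjTranspose hPω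
    rwa [conjTranspose_mul, hP.eq, conjTranspose_kronecker, conjTranspose_one,
      hω.isHermitian.eq] at this
  have h1 : S.trace ≤ 1 := by
    have := trace_mul_le hω h.trA_le
    rwa [Matrix.mul_one, htr, ← trA_one_kronecker_mul, trace_trA, ← Matrix.mul_assoc, hωP,
      ← mul_kronecker_mul, Matrix.one_mul, Matrix.mul_one, trace_kronecker, htr, mul_one] at this
  exact (Complex.le_def.1 h1).1

end Feasible

/-! ### The Choi matrix as a positive operator supported under `P`. -/

section Choi

variable {A B κ : Type*} [Fintype A] [DecidableEq A] [Fintype B] [DecidableEq B] [Fintype κ]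
  [DecidableEq κ]

theorem choiMatrix_apply (E : κ → Matrix B A ℂ) (x y : A × B) :
    choiMatrix E x y = ∑ k, E k x.2 x.1 * star (E k y.2 y.1) := by
  simp [choiMatrix, mul_apply, Matrix.sum_apply, single_apply, ite_and]

theorem choiMatrix_posSemidef (E : κ → Matrix B A ℂ) : (choiMatrix E).PosSemidef := by
  have : choiMatrix E = ∑ k, vecMulVec (E k).vec (star (E k).vec) := by
    ext x y
    simp [choiMatrix_apply, Matrix.sum_apply, vecMulVec_apply, vec]
  rw [this]
  exact posSemidef_sum _ fun k _ => posSemidef_vecMulVec_self_star _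

theorem choiProj_mul_choiMatrix {K : Submodule ℂ (Matrix B A ℂ)} {E : κ → Matrix B A ℂ}
    (hE : ∀ k, E k ∈ K) : choiProj K * choiMatrix E = choiMatrix E := by
  refine choiProj_mul_of_col fun y =>
    ⟨∑ k, star (E k y.2 y.1) • E k, Submodule.sum_mem _ fun k _ => K.smul_mem _ (hE k), ?_⟩
  ext x
  simp [choiMatrix_apply, vec, Matrix.sum_apply, mul_comm]

theorem IsKrausFamily.sum_choiMatrix {E : κ → Matrix B A ℂ} (hE : IsKrausFamily E) (a a' : A) :
    ∑ b, choiMatrix E (a, b) (a', b) = (1 : Matrix A A ℂ) a a' := by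
  have h := congrFun (congrFun hE a') a
  simp only [Matrix.sum_apply, mul_apply, conjTranspose_apply] at h
  simp only [choiMatrix_apply]
  -- Trace preservation yields the transposed entry, which is harmless because the identity is
  -- symmetric.
  have h1 : (1 : Matrix A A ℂ) a a' = (1 : Matrix A A ℂ) a' a := by simp [one_apply, eq_comm]
  rw [Finset.sum_comm, h1, ← h]
  simp only [mul_comm]

theorem trace_mul_kronecker_one {J : Matrix (A × B) (A × B) ℂ}
    (hJ : ∀ a a', ∑ b, J (a, b) (a', b) = (1 : Matrix A A ℂ) a a') (S : Matrix A A ℂ) :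
    (J * (S ⊗ₖ (1 : Matrix B B ℂ))).trace = S.trace := by
  have h : (J * (S ⊗ₖ (1 : Matrix B B ℂ))).trace =
      ∑ a, ∑ a', (∑ b, J (a, b) (a', b)) * S a' a := by
    simp only [trace, diag, mul_apply, Fintype.sum_prod_type, kronecker_apply, one_apply,
      mul_ite, mul_one, mul_zero, Finset.sum_ite_eq', Finset.mem_univ, if_true, Finset.sum_mul]
    exact Finset.sum_congr rfl fun a _ => Finset.sum_comm
  rw [h]
  simp [hJ, trace, one_apply]

theorem sum_biPow {ι : Type*} [Fintype ι] [DecidableEq ι] {J : Matrix (A × B) (A × B) ℂ}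
    (hJ : ∀ a a', ∑ b, J (a, b) (a', b) = (1 : Matrix A A ℂ) a a') (a a' : ι → A) :
    ∑ b, biPow ι J (a, b) (a', b) = (1 : Matrix (ι → A) (ι → A) ℂ) a a' := by
  rw [← tprod_one]
  simp [biPow_apply, tprod, ← hJ, Finset.prod_univ_sum]

end Choi

/-! ### Completing `tr_A U ≤ 𝟙` to an equality with auxiliary copies. -/

section Completion

variable {A B A' B' : Type*} [Fintype A'] [DecidableEq A'] [Fintype B'] [DecidableEq B']
  [Fintype A] [DecidableEq A] [Fintype B] [DecidableEq B]

/-- The pair `(S, U)` is feasible for the program defining `upsilon`, with Choi projection `P`. -/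
structure Feasible (P : Matrix (A × B) (A × B) ℂ) (S : Matrix A A ℂ)
    (U : Matrix (A × B) (A × B) ℂ) : Prop where
  nonneg : U.PosSemidef
  le : (S ⊗ₖ (1 : Matrix B B ℂ) - U).PosSemidef
  trA_eq : trA U = 1
  trace_eq : (P * (S ⊗ₖ (1 : Matrix B B ℂ) - U)).trace = 0

theorem Feasible.hatFeasible {P : Matrix (A × B) (A × B) ℂ} {S : Matrix A A ℂ}
    {U : Matrix (A × B) (A × B) ℂ} (h : Feasible P S U) : HatFeasible P S U where
  nonneg := h.nonneg
  le := h.le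
  trA_le := by rw [h.trA_eq, sub_self]; exact PosSemidef.zero
  trace_eq := h.trace_eq

/-- Feasibility is invariant under relabelling of the bases. -/
theorem Feasible.reindex {P : Matrix (A × B) (A × B) ℂ} {S : Matrix A A ℂ}
    {U : Matrix (A × B) (A × B) ℂ} (h : Feasible P S U) (e : A' ≃ A) (f : B' ≃ B) :
    Feasible (P.submatrix (e.prodCongr f) (e.prodCongr f)) (S.submatrix e e)
      (U.submatrix (e.prodCongr f) (e.prodCongr f)) := by
  have h1 : S.submatrix e e ⊗ₖ (1 : Matrix B' B' ℂ) =
      (S ⊗ₖ (1 : Matrix B B ℂ)).submatrix (e.prodCongr f) (e.prodCongr f) := by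
    ext
    simp [one_apply]
  refine ⟨h.nonneg.submatrix _, ?_, ?_, ?_⟩
  · rw [h1]
    exact h.le.submatrix (e.prodCongr f)
  · have h2 : trA (U.submatrix (e.prodCongr f) (e.prodCongr f)) = (trA U).submatrix f f := by
      ext b b'
      exact Equiv.sum_comp e fun a => U (a, f b) (a, f b')
    rw [h2, h.trA_eq, submatrix_one_equiv]
  · have h2 : (P * (S ⊗ₖ (1 : Matrix B B ℂ) - U)).submatrix (e.prodCongr f) (e.prodCongr f) =
      P.submatrix (e.prodCongr f) (e.prodCongr f) * (S.submatrix e e ⊗ₖ (1 : Matrix B' B' ℂ) -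
        U.submatrix (e.prodCongr f) (e.prodCongr f)) := by
      rw [h1, ← submatrix_mul_equiv (e₂ := e.prodCongr f)]
      rfl
    rw [← h2, ← h.trace_eq]
    exact Equiv.sum_comp (e.prodCongr f) fun x => (P * (S ⊗ₖ (1 : Matrix B B ℂ) - U)) x x

/-- A feasible pair for `upsilonHat` can be completed to one for `upsilon` at the cost of a factor
`C`, by means of an auxiliary graph with Choi projection `P'` for which there is a Hermitian matrix
`V` supported in the complement of `P'` with the same partial trace as `P'`. -/
theorem HatFeasible.exists_feasible_box [Nonempty B] [Nonempty A']
    {P U : Matrix (A × B) (A × B) ℂ} {S : Matrix A A ℂ} (h : HatFeasible P S U)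
    {P' V : Matrix (A' × B') (A' × B') ℂ} (hP' : P'.PosSemidef) (hPP' : P' * P' = P')
    (hQ' : (1 - P').PosSemidef) (hPV : P' * V = 0) (htr : trA V = trA P') {C : ℝ} (hC : 0 < C)
    (hVC : ((C : ℂ) • (1 - P') - V).PosSemidef) (hVC' : ((C : ℂ) • (1 - P') + V).PosSemidef)
    (hCS : C ≤ S.trace.re) :
    ∃ S' U', Feasible (box P P') S' U' ∧ S'.trace.re = S.trace.re / C := by
  set s : ℝ := S.trace.re with hs
  have hS := h.posSemidef
  have hsS : S.trace = (s : ℂ) := hS.isHermitian.coe_re_trace.symm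
  have hs0 : 0 < s := hC.trans_le hCS
  -- This weight makes `x σ ⊗ 𝟙` and the `V` term of `W` balance, through `x s = C`; the hypothesis
  -- `C ≤ s` gives `x ≤ 1`.
  set x : ℝ := C / s with hx
  set d : ℝ := (Fintype.card A' : ℝ) with hd
  have hd0 : 0 < d := by rw [hd]; exact_mod_cast Fintype.card_pos
  have hx0 : 0 < x := div_pos hC hs0
  have hx1 : x ≤ 1 := (div_le_one hs0).2 hCS
  set ρ := trA U with hρ
  have hρ0 : ρ.PosSemidef := trA_posSemidef h.nonneg
  set c : ℝ := C * d with hc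
  have hc0 : 0 < c := mul_pos hC hd0
  have hsC : (s : ℂ) ≠ 0 := by exact_mod_cast hs0.ne'
  have hcC : (c : ℂ) ≠ 0 := by exact_mod_cast hc0.ne'
  have hxs : (x : ℂ) * s = C := by
    rw [hx]; push_cast; field_simp
  have nn : ∀ {r : ℝ}, 0 ≤ r → (0 : ℂ) ≤ (r : ℂ) := fun hr => by exact_mod_cast hr
  let σ := S ⊗ₖ (1 : Matrix B B ℂ)
  let τ := S ⊗ₖ ρ
  have hτ : τ.PosSemidef := hS.kronecker hρ0
  have hστ : (σ - τ).PosSemidef := by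
    have e : σ - τ = S ⊗ₖ (1 - ρ) := by
      ext
      simp [σ, τ, mul_sub]
    rw [e]
    exact hS.kronecker h.trA_le
  have hσ : σ.PosSemidef := h.kronecker_posSemidef
  have hσU : (σ - U).PosSemidef := h.le
  -- Here `tr_A τ = s ρ` and `tr_A V = tr_A P'`, so the last term cancels the partial trace `(1 - x)
  -- ρ ⊗ tr_A P'` of the first. What remains is the partial trace of `x σ ⊗ 𝟙`, namely `x s d 𝟙 = c
  -- 𝟙`, whence the normalization by `c`.
  let W := ((1 - x : ℝ) : ℂ) • box U P' + (x : ℂ) • box σ 1 -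
    ((1 - x : ℝ) : ℂ) • (s : ℂ)⁻¹ • box τ V
  have hσ1 : (S ⊗ₖ (1 : Matrix A' A' ℂ)) ⊗ₖ (1 : Matrix (B × B') (B × B') ℂ) =
      box σ (1 : Matrix (A' × B') (A' × B') ℂ) := by
    rw [← one_kronecker_one, ← one_kronecker_one, box_kronecker]
  -- Both `W` and `σ ⊗ 𝟙 - W` are split into manifestly positive terms, using `U ≤ σ`, `τ ≤ σ` (from
  -- `ρ ≤ 𝟙`) and `±V ≤ C (𝟙 - P')`.
  have e1 : W = ((1 - x : ℝ) : ℂ) • box U P' + (x : ℂ) • box σ P' +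
      ((x : ℂ) • box (σ - τ) (1 - P') + ((x * x : ℝ) : ℂ) • box τ (1 - P') +
      (((1 - x) * s⁻¹ : ℝ) : ℂ) • box τ ((C : ℂ) • (1 - P') - V)) := by
    simp only [W, box_sub_left, box_sub_right, box_smul_right, ← hxs]
    push_cast
    match_scalars <;> field_simp <;> ring
  have e2 : box σ 1 - W = ((1 - x : ℝ) : ℂ) • (box (σ - U) P' + (box (σ - τ) (1 - P') +
      ((1 - x : ℝ) : ℂ) • box τ (1 - P') +
      ((s⁻¹ : ℝ) : ℂ) • box τ ((C : ℂ) • (1 - P') + V))) := by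
    simp only [W, box_sub_left, box_sub_right, box_add_right, box_smul_right, ← hxs]
    push_cast
    match_scalars <;> field_simp <;> ring
  have hc' : (0 : ℂ) ≤ ((c⁻¹ : ℝ) : ℂ) := nn (inv_nonneg.2 hc0.le)
  refine ⟨((c⁻¹ : ℝ) : ℂ) • (S ⊗ₖ 1), ((c⁻¹ : ℝ) : ℂ) • W, ⟨?_, ?_, ?_, ?_⟩, ?_⟩
  · refine PosSemidef.smul ?_ hc'
    rw [e1]
    refine (((box_posSemidef h.nonneg hP').smul (nn (sub_nonneg.2 hx1))).add
      ((box_posSemidef hσ hP').smul (nn hx0.le))).add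
      ((((box_posSemidef hστ hQ').smul (nn hx0.le)).add
      ((box_posSemidef hτ hQ').smul (nn (mul_nonneg hx0.le hx0.le)))).add
      ((box_posSemidef hτ hVC).smul
        (nn (mul_nonneg (sub_nonneg.2 hx1) (inv_nonneg.2 hs0.le)))))
  · rw [smul_kronecker, hσ1, ← smul_sub]
    refine PosSemidef.smul ?_ hc'
    rw [e2]
    exact ((box_posSemidef hσU hP').add (((box_posSemidef hστ hQ').add
      ((box_posSemidef hτ hQ').smul (nn (sub_nonneg.2 hx1)))).add
      ((box_posSemidef hτ hVC').smul (nn (inv_nonneg.2 hs0.le))))).smul (nn (sub_nonneg.2 hx1))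
  · have : trA W = (c : ℂ) • 1 := by
      simp only [W, trA_sub, trA_add, trA_smul, trA_box, htr, σ, τ, trA_kronecker, trA_one, hsS,
        smul_kronecker, kronecker_smul, one_kronecker_one]
      rw [inv_smul_smul₀ hsC, add_sub_cancel_left, smul_smul, smul_smul, mul_right_comm, hxs, hc,
        hd]
      push_cast
      rfl
    rw [trA_smul, this, smul_smul, Complex.ofReal_inv, inv_mul_cancel₀ hcC, one_smul]
  -- In `σ ⊗ 𝟙 - W` only the term with `(σ - U) ⊗ P'` survives multiplication by `P ⊗ P'`, and its
  -- trace has the factor `tr P (σ - U) = 0`.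
  · have hPQ : P' * (1 - P') = 0 := by rw [Matrix.mul_sub, Matrix.mul_one, hPP', sub_self]
    rw [smul_kronecker, hσ1, ← smul_sub, e2]
    simp only [Matrix.mul_smul, Matrix.mul_add, ← box_mul, hPQ, hPV, trace_smul,
      trace_box, box_zero_right, smul_zero, add_zero]
    rw [show (P * (σ - U)).trace = 0 from h.trace_eq]
    simp
  · rw [trace_smul, trace_kronecker, trace_one, hsS]
    have : ((c⁻¹ : ℝ) : ℂ) • ((s : ℂ) * (Fintype.card A' : ℂ)) = ((s / C : ℝ) : ℂ) := by
      rw [hc, hd]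
      have : (C : ℂ) ≠ 0 := by exact_mod_cast hC.ne'
      have : (Fintype.card A' : ℂ) ≠ 0 := by exact_mod_cast Fintype.card_pos.ne'
      push_cast
      rw [smul_eq_mul]
      field_simp
    rw [this, Complex.ofReal_re]

/-- If `tr_A (𝟙 - P)` is invertible, then two copies of `P` have the auxiliary matrix required in
`HatFeasible.exists_feasible_box`. -/
theorem exists_trA_eq_trA_box {P : Matrix (A × B) (A × B) ℂ} (hP : P.IsHermitian)
    (hPP : P * P = P) (hQ : IsUnit (trA (1 - P))) :
    ∃ (V : Matrix ((A × A) × (B × B)) ((A × A) × (B × B)) ℂ) (C : ℝ), 0 < C ∧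
      box P P * V = 0 ∧ trA V = trA (box P P) ∧
      ((C : ℂ) • (1 - box P P) - V).PosSemidef ∧ ((C : ℂ) • (1 - box P P) + V).PosSemidef := by
  set Q := 1 - P with hQdef
  set R := trA P with hR
  have hRh : Rᴴ = R := by rw [hR, ← trA_conjTranspose, hP.eq]
  have hPQ : P * Q = 0 := by rw [hQdef, Matrix.mul_sub, Matrix.mul_one, hPP, sub_self]
  have hQP : Q * P = 0 := by rw [hQdef, Matrix.sub_mul, Matrix.one_mul, hPP, sub_self]
  have hdet := (isUnit_iff_isUnit_det _).1 hQ
  -- The first factor is killed by `P` on the left and the second by `P` on the right, so their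
  -- tensor product is killed by `P ⊗ P` on both sides. Each factor has partial trace `R`: the
  -- inverse of `tr_A Q` cancels because operators on `B` pass through `trA`.
  let Z := box (Q * ((1 : Matrix A A ℂ) ⊗ₖ ((trA Q)⁻¹ * R)))
    (((1 : Matrix A A ℂ) ⊗ₖ (R * (trA Q)⁻¹)) * Q)
  have hPZ : box P P * Z = 0 := by
    rw [← box_mul, ← Matrix.mul_assoc, hPQ, Matrix.zero_mul, box_zero_left]
  have hZP : Z * box P P = 0 := by
    rw [← box_mul, Matrix.mul_assoc _ Q, hQP, Matrix.mul_zero, box_zero_right]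
  have hZ : trA Z = trA (box P P) := by
    rw [trA_box, trA_box, trA_mul_one_kronecker, trA_one_kronecker_mul, ← Matrix.mul_assoc,
      mul_nonsing_inv _ hdet, Matrix.one_mul, Matrix.mul_assoc, nonsing_inv_mul _ hdet,
      Matrix.mul_one]
  have hPPh : (box P P)ᴴ = box P P := by rw [box_conjTranspose, hP.eq]
  -- Taking the Hermitian part preserves the partial trace, since `tr_A (P ⊗ P)` is Hermitian.
  let V := (1 / 2 : ℂ) • (Z + Zᴴ)
  have hV : V.IsHermitian := by
    simp [V, IsHermitian, conjTranspose_smul, add_comm]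
  have hPV : box P P * V = 0 := by
    have := congrArg conjTranspose hZP
    rw [conjTranspose_mul, hPPh, conjTranspose_zero] at this
    rw [Matrix.mul_smul, Matrix.mul_add, hPZ, this, add_zero, smul_zero]
  have hVP : V * box P P = 0 := by
    have := congrArg conjTranspose hPV
    rwa [conjTranspose_mul, hPPh, conjTranspose_zero, hV.eq] at this
  -- The bounds `±V ≤ C 𝟙` are compressed below to the complement of `P ⊗ P`, where `V` lives.
  obtain ⟨C, hC, h1, h2⟩ := exists_posSemidef_smul_one_sub_add hV
  have hQ2 : (1 - box P P)ᴴ = 1 - box P P := by rw [conjTranspose_sub, hPPh, conjTranspose_one]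
  have hQQ2 : (1 - box P P) * (1 - box P P) = 1 - box P P := by
    simp [Matrix.mul_sub, Matrix.sub_mul, ← box_mul, hPP]
  have hQV : (1 - box P P) * V = V := by rw [Matrix.sub_mul, hPV, Matrix.one_mul, sub_zero]
  have hVQ : V * (1 - box P P) = V := by rw [Matrix.mul_sub, hVP, Matrix.mul_one, sub_zero]
  refine ⟨V, C, hC, hPV, ?_, ?_, ?_⟩
  · rw [trA_smul, trA_add, trA_conjTranspose, hZ, ← trA_conjTranspose, hPPh]
    module
  · have := h1.conjTranspose_mul_mul_same (1 - box P P)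
    rwa [hQ2, Matrix.mul_sub (1 - box P P), Matrix.sub_mul _ _ (1 - box P P), hQV, hVQ,
      Matrix.mul_smul, Matrix.smul_mul, Matrix.mul_one, hQQ2] at this
  · have := h2.conjTranspose_mul_mul_same (1 - box P P)
    rwa [hQ2, Matrix.mul_add, Matrix.add_mul, hQV, hVQ, Matrix.mul_smul, Matrix.smul_mul,
      Matrix.mul_one, hQQ2] at this

/-- The splitting of a word of length `n + 2` into its last `n` letters and its first two. -/
def wordEquiv (A : Type*) (n : ℕ) : (Fin (n + 2) → A) ≃ (Fin n → A) × (A × A) where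
  toFun a := (fun i => a i.succ.succ, a 0, a 1)
  invFun p := Fin.cons p.2.1 (Fin.cons p.2.2 p.1)
  left_inv a := by
    ext i
    refine Fin.cases rfl (fun j => ?_) i
    refine Fin.cases rfl (fun k => rfl) j
  right_inv p := rfl

theorem box_biPow_submatrix (P : Matrix (A × B) (A × B) ℂ) (n : ℕ) :
    (box (biPow (Fin n) P) (box P P)).submatrix ((wordEquiv A n).prodCongr (wordEquiv B n))
      ((wordEquiv A n).prodCongr (wordEquiv B n)) = biPow (Fin (n + 2)) P := by
  ext x y
  rw [biPow_apply, Fin.prod_univ_succ, Fin.prod_univ_succ, ← mul_assoc]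
  exact mul_comm (∏ i : Fin n, P (x.1 i.succ.succ, x.2 i.succ.succ)
    (y.1 i.succ.succ, y.2 i.succ.succ))
    (P (x.1 0, x.2 0) (y.1 0, y.2 0) * P (x.1 1, x.2 1) (y.1 1, y.2 1))

end Completion

/-! ### Finiteness of the optimal values and achievable rates. -/

section Values

variable {A B : Type*} [Fintype A] [DecidableEq A] [Fintype B] [DecidableEq B]
  {K : Submodule ℂ (Matrix B A ℂ)}

theorem upsilon_eq_sSup (K : Submodule ℂ (Matrix B A ℂ)) :
    upsilon K = sSup {t : ℝ | ∃ S U, Feasible (choiProj K) S U ∧ t = S.trace.re} := by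
  refine congrArg sSup (Set.ext fun t => ?_)
  exact ⟨fun ⟨S, U, h1, h2, h3, h4, h5⟩ => ⟨S, U, ⟨h1, h2, h3, h4⟩, h5⟩,
    fun ⟨S, U, ⟨h1, h2, h3, h4⟩, h5⟩ => ⟨S, U, h1, h2, h3, h4, h5⟩⟩

theorem upsilonHat_eq_sSup (K : Submodule ℂ (Matrix B A ℂ)) :
    upsilonHat K = sSup {t : ℝ | ∃ S U, HatFeasible (choiProj K) S U ∧ t = S.trace.re} := by
  refine congrArg sSup (Set.ext fun t => ?_)
  exact ⟨fun ⟨S, U, h1, h2, h3, h4, h5⟩ => ⟨S, U, ⟨h1, h2, h3, h4⟩, h5⟩,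
    fun ⟨S, U, ⟨h1, h2, h3, h4⟩, h5⟩ => ⟨S, U, h1, h2, h3, h4, h5⟩⟩

theorem packing_eq_sSup (K : Submodule ℂ (Matrix B A ℂ)) :
    packing K = sSup {t : ℝ | ∃ S, PackingFeasible (choiProj K) S ∧ t = S.trace.re} := by
  refine congrArg sSup (Set.ext fun t => ?_)
  exact ⟨fun ⟨S, h1, h2, h3⟩ => ⟨S, ⟨h1, h2⟩, h3⟩, fun ⟨S, ⟨h1, h2⟩, h3⟩ => ⟨S, h1, h2, h3⟩⟩

/-- The pair `S = 𝟙 / d_A`, `U = S ⊗ 𝟙` is always feasible, with value `1`. -/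
theorem exists_feasible_trace_eq_one [Nonempty A] (P : Matrix (A × B) (A × B) ℂ) :
    ∃ S U, Feasible P S U ∧ (1 : ℝ) = S.trace.re := by
  have hA : (Fintype.card A : ℂ) ≠ 0 := by exact_mod_cast Fintype.card_pos.ne'
  have hA0 : (0 : ℂ) ≤ (Fintype.card A : ℂ)⁻¹ := by
    rw [← Complex.ofReal_natCast, ← Complex.ofReal_inv]
    exact_mod_cast inv_nonneg.2 (Nat.cast_nonneg (α := ℝ) _)
  have htr : ((Fintype.card A : ℂ)⁻¹ • (1 : Matrix A A ℂ)).trace = 1 := by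
    rw [trace_smul, trace_one, smul_eq_mul, inv_mul_cancel₀ hA]
  refine ⟨(Fintype.card A : ℂ)⁻¹ • 1, ((Fintype.card A : ℂ)⁻¹ • 1) ⊗ₖ 1, ⟨?_, ?_, ?_, ?_⟩, ?_⟩
  · exact (PosSemidef.one.smul hA0).kronecker PosSemidef.one
  · rw [sub_self]; exact PosSemidef.zero
  · rw [trA_kronecker, htr, one_smul]
  · rw [sub_self, Matrix.mul_zero, trace_zero]
  · rw [htr, Complex.one_re]

/-- A uniform bound on the values of all feasible pairs, multiplicative in the number of copies. -/
theorem IsNCBipartiteGraph.exists_bound (hK : IsNCBipartiteGraph K) :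
    ∃ C : ℝ, 0 < C ∧
      (∀ (n : ℕ) S U, HatFeasible (choiProj (tensorPow K n)) S U →
        S.trace.re ≤ (C * Fintype.card B) ^ n) ∧
      (∀ S U, HatFeasible (choiProj K) S U → S.trace.re ≤ C * Fintype.card B) ∧
      ∀ S, PackingFeasible (choiProj K) S → S.trace.re ≤ C * Fintype.card B := by
  obtain ⟨r, E, hE, rfl⟩ := hK
  set K := Submodule.span ℂ (Set.range E)
  have hJ := choiMatrix_posSemidef E
  obtain ⟨C, hC, hJC, -⟩ := exists_posSemidef_smul_one_sub_add hJ.isHermitian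
  have hPJ : choiProj K * choiMatrix E = choiMatrix E :=
    choiProj_mul_choiMatrix fun k => Submodule.subset_span ⟨k, rfl⟩
  have hPh := choiProj_isHermitian K
  have hPP := choiProj_mul_self K
  refine ⟨C, hC, fun n S U h => ?_, fun S U h => ?_, fun S h => ?_⟩
  · have h1 : ((((C ^ n : ℝ) : ℂ) • 1 - biPow (Fin n) (choiMatrix E))).PosSemidef := by
      have := biPow_sub_posSemidef (ι := Fin n) hJ hJC
      rw [biPow_smul, biPow_one, Fintype.card_fin] at this
      push_cast
      exact this
    have := h.trace_re_le (choiProj_isHermitian _) (choiProj_mul_self _)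
      (J := biPow (Fin n) (choiMatrix E)) (by rw [choiProj_tensorPow, ← biPow_mul, hPJ])
      (trace_mul_kronecker_one (sum_biPow hE.sum_choiMatrix) S) (pow_nonneg hC.le n) h1
    simpa [mul_pow] using this
  · exact h.trace_re_le hPh hPP hPJ (trace_mul_kronecker_one hE.sum_choiMatrix S) hC.le hJC
  · exact h.trace_re_le hPh hPP hPJ hJ.isHermitian
      (trace_mul_kronecker_one hE.sum_choiMatrix S) hC.le hJC

theorem IsNCBipartiteGraph.nonempty [Nonempty A] (hK : IsNCBipartiteGraph K) : Nonempty B := by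
  by_contra hB
  rw [not_nonempty_iff] at hB
  obtain ⟨r, E, hE, -⟩ := hK
  obtain ⟨a⟩ := ‹Nonempty A›
  have := congrFun (congrFun hE a) a
  simp [Matrix.sum_apply, mul_apply] at this

theorem IsNCBipartiteGraph.trace_re_le_upsilon (hK : IsNCBipartiteGraph K) {n : ℕ} {S U}
    (h : Feasible (choiProj (tensorPow K n)) S U) : S.trace.re ≤ upsilon (tensorPow K n) := by
  obtain ⟨C, -, hC, -, -⟩ := hK.exists_bound
  rw [upsilon_eq_sSup]
  refine le_csSup ⟨(C * Fintype.card B) ^ n, ?_⟩ ⟨S, U, h, rfl⟩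
  rintro _ ⟨S, U, h, rfl⟩
  exact hC n S U h.hatFeasible

theorem IsNCBipartiteGraph.trace_re_le_upsilonHat (hK : IsNCBipartiteGraph K) {S U}
    (h : HatFeasible (choiProj K) S U) :
    S.trace.re ≤ upsilonHat K := by
  obtain ⟨C, -, -, hC, -⟩ := hK.exists_bound
  rw [upsilonHat_eq_sSup]
  refine le_csSup ⟨C * Fintype.card B, ?_⟩ ⟨S, U, h, rfl⟩
  rintro _ ⟨S, U, h, rfl⟩
  exact hC S U h

theorem IsNCBipartiteGraph.trace_re_le_packing (hK : IsNCBipartiteGraph K) {S}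
    (h : PackingFeasible (choiProj K) S) :
    S.trace.re ≤ packing K := by
  obtain ⟨C, -, -, -, hC⟩ := hK.exists_bound
  rw [packing_eq_sSup]
  refine le_csSup ⟨C * Fintype.card B, ?_⟩ ⟨S, h, rfl⟩
  rintro _ ⟨S, h, rfl⟩
  exact hC S h

variable [Nonempty A]

theorem IsNCBipartiteGraph.one_le_upsilon (hK : IsNCBipartiteGraph K) (n : ℕ) :
    1 ≤ upsilon (tensorPow K n) := by
  obtain ⟨S, U, h, h1⟩ := exists_feasible_trace_eq_one (choiProj (tensorPow K n))
  rw [h1]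
  exact hK.trace_re_le_upsilon h

theorem IsNCBipartiteGraph.one_le_upsilonHat (hK : IsNCBipartiteGraph K) : 1 ≤ upsilonHat K := by
  obtain ⟨S, U, h, h1⟩ := exists_feasible_trace_eq_one (choiProj K)
  rw [h1]
  exact hK.trace_re_le_upsilonHat h.hatFeasible

theorem IsNCBipartiteGraph.le_capacity (hK : IsNCBipartiteGraph K) {n : ℕ} (hn : 1 ≤ n) :
    (1 / (n : ℝ)) * Real.logb 2 (upsilon (tensorPow K n)) ≤ capacity K := by
  obtain ⟨C, hC0, hC, -, -⟩ := hK.exists_bound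
  refine le_csSup ⟨Real.logb 2 (C * Fintype.card B), ?_⟩ ⟨n, hn, rfl⟩
  rintro _ ⟨n, hn, rfl⟩
  have hn0 : (0 : ℝ) < n := by exact_mod_cast hn
  have h1 : upsilon (tensorPow K n) ≤ (C * Fintype.card B) ^ n := by
    rw [upsilon_eq_sSup]
    refine csSup_le ?_ ?_
    · exact ⟨1, exists_feasible_trace_eq_one (choiProj (tensorPow K n))⟩
    · rintro _ ⟨S, U, h, rfl⟩
      exact hC n S U h.hatFeasible
  have h2 := Real.logb_le_logb_of_le one_lt_two (zero_lt_one.trans_le (hK.one_le_upsilon n)) h1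
  rw [Real.logb_pow] at h2
  rw [one_div, inv_mul_le_iff₀ hn0]
  exact h2

theorem IsNCBipartiteGraph.capacity_nonneg (hK : IsNCBipartiteGraph K) : 0 ≤ capacity K :=
  (mul_nonneg (by positivity) (Real.logb_nonneg one_lt_two (hK.one_le_upsilon 1))).trans
    (hK.le_capacity le_rfl)

/-- If the partial trace of the complement of the Choi projection is invertible, the value of every
feasible pair for `upsilonHat` is an achievable rate. -/
theorem IsNCBipartiteGraph.logb_trace_le_capacity (hK : IsNCBipartiteGraph K)
    (hQ : IsUnit (trA (1 - choiProj K))) {S U}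
    (h : HatFeasible (choiProj K) S U) (hS : 1 < S.trace.re) :
    Real.logb 2 S.trace.re ≤ capacity K := by
  have hB : Nonempty B := hK.nonempty
  set s := S.trace.re with hs
  have hP := choiProj_isHermitian K
  have hPP := choiProj_mul_self K
  obtain ⟨V, C, hC, hPV, htr, hVC, hVC'⟩ := exists_trA_eq_trA_box hP hPP hQ
  have hstr : S.trace = (s : ℂ) := h.posSemidef.isHermitian.coe_re_trace.symm
  have hbox : (1 - box (choiProj K) (choiProj K)).PosSemidef := by
    refine posSemidef_of_isHermitian_of_mul_self ?_ ?_
    · rw [IsHermitian, conjTranspose_sub, box_conjTranspose, hP.eq, conjTranspose_one]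
    · simp [Matrix.mul_sub, Matrix.sub_mul, ← box_mul, hPP]
  -- Take `n` copies of `(S, U)` and complete them with two further copies of `K`, so that
  -- `Υ(K^{⊗(n+2)}) ≥ s^n / C`.
  have key : ∀ n : ℕ, C ≤ s ^ n →
      n * Real.logb 2 s - Real.logb 2 C ≤ (n + 2) * capacity K := by
    intro n hn
    have hre : (tprod fun _ : Fin n => S).trace.re = s ^ n := by
      rw [trace_tprod, Finset.prod_const, hstr, Finset.card_univ, Fintype.card_fin,
        ← Complex.ofReal_pow, Complex.ofReal_re]
    obtain ⟨S', U', hf, hS'⟩ := (h.biPow (ι := Fin n)).exists_feasible_box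
      (box_posSemidef (choiProj_posSemidef K) (choiProj_posSemidef K))
      (by rw [← box_mul, hPP]) hbox hPV htr hC hVC hVC' (by rwa [hre])
    have hf' := hf.reindex (wordEquiv A n) (wordEquiv B n)
    rw [box_biPow_submatrix, ← choiProj_tensorPow] at hf'
    have h1 := hK.trace_re_le_upsilon hf'
    have h2 : (S'.submatrix (wordEquiv A n) (wordEquiv A n)).trace = S'.trace :=
      Equiv.sum_comp (wordEquiv A n) fun a => S' a a
    rw [h2, hS', hre] at h1
    have hpos : 0 < s ^ n := pow_pos (zero_lt_one.trans hS) n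
    have h3 := Real.logb_le_logb_of_le one_lt_two (div_pos hpos hC) h1
    rw [Real.logb_div hpos.ne' hC.ne', Real.logb_pow] at h3
    have h4 := hK.le_capacity (n := n + 2) (by omega)
    rw [one_div, inv_mul_le_iff₀ (by positivity)] at h4
    push_cast at h4
    exact h3.trans h4
  by_contra hlt
  rw [not_le] at hlt
  obtain ⟨N, hN⟩ := pow_unbounded_of_one_lt C hS
  -- If the capacity were below `log₂ s`, `key` would bound `n (log₂ s - capacity)` by `2 capacity +
  -- log₂ C` for all large `n`.
  obtain ⟨m, hm⟩ := exists_nat_gt ((2 * capacity K + Real.logb 2 C) /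
    (Real.logb 2 s - capacity K))
  rw [div_lt_iff₀ (sub_pos.2 hlt)] at hm
  have h1 := key (max m N) (hN.le.trans (pow_le_pow_right₀ hS.le (le_max_right m N)))
  have h2 : (m : ℝ) ≤ (max m N : ℕ) := by exact_mod_cast le_max_left m N
  have h3 := mul_le_mul_of_nonneg_right h2 (sub_pos.2 hlt).le
  linarith

end Values

/-! ### The degenerate case: `tr_A (𝟙 - P)` singular. -/

section Degenerate

variable {A B : Type*} [Fintype A] [DecidableEq A] [Fintype B] [DecidableEq B]
  {K : Submodule ℂ (Matrix B A ℂ)}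

/-- If `tr_A (𝟙 - P)` is singular, then `A ⊗ supp ω` lies in the range of `P` for some state
`ω`. -/
theorem exists_state_of_not_posDef {P : Matrix (A × B) (A × B) ℂ} (hP : P.IsHermitian)
    (hPP : P * P = P) (h : ¬ (trA (1 - P)).PosDef) :
    ∃ ω : Matrix B B ℂ, ω.PosSemidef ∧ ω.trace = 1 ∧
      P * ((1 : Matrix A A ℂ) ⊗ₖ ω) = (1 : Matrix A A ℂ) ⊗ₖ ω := by
  have hQ : (1 - P).IsHermitian := isHermitian_one.sub hP
  have hQQ : (1 - P) * (1 - P) = 1 - P := by simp [Matrix.mul_sub, Matrix.sub_mul, hPP]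
  have hps := trA_posSemidef (posSemidef_of_isHermitian_of_mul_self hQ hQQ)
  rw [hps.posDef_iff_isUnit, isUnit_iff_isUnit_det, isUnit_iff_ne_zero, not_not] at h
  obtain ⟨v, hv, hv0⟩ := exists_mulVec_eq_zero_iff.2 h
  have hr : 0 < star v ⬝ᵥ v := dotProduct_star_self_pos_iff.2 hv
  set r := star v ⬝ᵥ v with hrdef
  -- The normalized projector onto a kernel vector of `tr_A (𝟙 - P)`; then `tr (𝟙 - P)(𝟙 ⊗ ω) = 0`,
  -- and positivity upgrades this to a vanishing product.
  let ω := r⁻¹ • vecMulVec v (star v)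
  have hω : ω.PosSemidef := (posSemidef_vecMulVec_self_star v).smul (inv_nonneg.2 hr.le)
  refine ⟨ω, hω, ?_, ?_⟩
  · rw [trace_smul, trace_vecMulVec, dotProduct_comm, smul_eq_mul, inv_mul_cancel₀ hr.ne']
  · have h1 : ((1 - P) * ((1 : Matrix A A ℂ) ⊗ₖ ω)).trace = 0 := by
      rw [← trace_trA, trA_mul_one_kronecker, Matrix.mul_smul, mul_vecMulVec, hv0]
      simp
    have h2 := mul_eq_zero_of_trace_eq_zero hQ hQQ (PosSemidef.one.kronecker hω) h1
    have h3 := congrArg conjTranspose h2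
    rw [conjTranspose_mul, hQ.eq, conjTranspose_kronecker, conjTranspose_one, conjTranspose_zero,
      hω.isHermitian.eq, Matrix.sub_mul, Matrix.one_mul, sub_eq_zero] at h3
    exact h3.symm

variable [Nonempty A]

theorem upsilonHat_le_one_of_not_posDef (h : ¬ (trA (1 - choiProj K)).PosDef) :
    upsilonHat K ≤ 1 := by
  obtain ⟨ω, hω, htr, hPω⟩ :=
    exists_state_of_not_posDef (choiProj_isHermitian K) (choiProj_mul_self K) h
  rw [upsilonHat_eq_sSup]
  refine Real.sSup_le ?_ zero_le_one
  rintro _ ⟨S, U, hSU, rfl⟩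
  exact hSU.trace_re_le_one (choiProj_isHermitian K) (choiProj_mul_self K) hω htr hPω

theorem packing_le_one_of_not_posDef (h : ¬ (trA (1 - choiProj K)).PosDef) :
    packing K ≤ 1 := by
  obtain ⟨ω, hω, htr, hPω⟩ :=
    exists_state_of_not_posDef (choiProj_isHermitian K) (choiProj_mul_self K) h
  rw [packing_eq_sSup]
  refine Real.sSup_le ?_ zero_le_one
  rintro _ ⟨S, hS, rfl⟩
  exact hS.trace_re_le_one (choiProj_isHermitian K) hω htr hPω

theorem IsNCBipartiteGraph.capacity_nonpos_of_not_posDef (hK : IsNCBipartiteGraph K)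
    (h : ¬ (trA (1 - choiProj K)).PosDef) :
    capacity K ≤ 0 := by
  obtain ⟨ω, hω, htr, hPω⟩ :=
    exists_state_of_not_posDef (choiProj_isHermitian K) (choiProj_mul_self K) h
  refine Real.sSup_le ?_ le_rfl
  rintro _ ⟨n, hn, rfl⟩
  refine mul_nonpos_of_nonneg_of_nonpos (by positivity) ?_
  have hle : upsilon (tensorPow K n) ≤ 1 := by
    rw [upsilon_eq_sSup]
    refine Real.sSup_le ?_ zero_le_one
    rintro _ ⟨S, U, hSU, rfl⟩
    refine hSU.hatFeasible.trace_re_le_one (choiProj_isHermitian _) (choiProj_mul_self _)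
      (tprod_posSemidef fun _ => hω) (by rw [trace_tprod]; simp [htr]) ?_
    rw [choiProj_tensorPow, ← tprod_one, ← biPow_kronecker, ← biPow_mul, hPω]
  exact Real.logb_nonpos one_lt_two (zero_le_one.trans (hK.one_le_upsilon n)) hle

end Degenerate

/-! ### Lower bounds by `d_A / ‖P_B‖` and the capacity bound. -/

section LowerBounds

variable {A B : Type*} [Fintype A] [DecidableEq A] [Fintype B] [DecidableEq B]
  {K : Submodule ℂ (Matrix B A ℂ)}

theorem posSemidef_one_sub_inv_smul {X : Matrix B B ℂ} (hX : X.IsHermitian)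
    (h0 : 0 < opNorm X) : (1 - ((opNorm X)⁻¹ : ℂ) • X).PosSemidef := by
  have h1 : (0 : ℂ) ≤ ((opNorm X)⁻¹ : ℂ) := by
    rw [← Complex.ofReal_inv]
    exact_mod_cast inv_nonneg.2 h0.le
  have h2 : (opNorm X : ℂ) ≠ 0 := by exact_mod_cast h0.ne'
  have := (posSemidef_opNorm_smul_one_sub hX).smul h1
  rwa [smul_sub, inv_smul_smul₀ h2] at this

theorem isHermitian_trA_choiProj (K : Submodule ℂ (Matrix B A ℂ)) :
    (trA (choiProj K)).IsHermitian :=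
  (trA_posSemidef (choiProj_posSemidef K)).isHermitian

/-- If `P_B = 0` then `tr P = 0`, so `P = 0` and `K = 0`, contradicting `∑ Eᴴ E = 𝟙` on a nonzero
space. -/
theorem IsNCBipartiteGraph.opNorm_pos [Nonempty A] (hK : IsNCBipartiteGraph K) :
    0 < opNorm (trA (choiProj K)) := by
  refine lt_of_le_of_ne (opNorm_nonneg _) fun h => ?_
  have h1 := (choiProj_posSemidef K).trace_eq_zero_iff.1
    (by rw [← trace_trA, opNorm_eq_zero.1 h.symm, trace_zero])
  have h2 : ∀ F ∈ K, F = 0 := fun F hF => by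
    have := choiProj_mulVec_vec hF
    rw [h1, zero_mulVec] at this
    exact vec_eq_zero_iff.1 this.symm
  obtain ⟨r, E, hE, rfl⟩ := hK
  obtain ⟨a⟩ := ‹Nonempty A›
  have := congrFun (congrFun hE a) a
  simp [h2 _ (Submodule.subset_span ⟨_, rfl⟩)] at this

theorem IsNCBipartiteGraph.div_opNorm_le_upsilonHat [Nonempty A] (hK : IsNCBipartiteGraph K) :
    (Fintype.card A : ℝ) / opNorm (trA (choiProj K)) ≤ upsilonHat K := by
  have h0 := hK.opNorm_pos
  have hc : (0 : ℂ) ≤ ((opNorm (trA (choiProj K)))⁻¹ : ℂ) := by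
    rw [← Complex.ofReal_inv]
    exact_mod_cast inv_nonneg.2 h0.le
  have h := hK.trace_re_le_upsilonHat (S := ((opNorm (trA (choiProj K)))⁻¹ : ℂ) • 1)
    (U := ((opNorm (trA (choiProj K)))⁻¹ : ℂ) • choiProj K) ⟨(choiProj_posSemidef K).smul hc, ?_,
      ?_, ?_⟩
  · convert h using 1
    rw [trace_smul, trace_one, smul_eq_mul, ← Complex.ofReal_inv, Complex.re_ofReal_mul,
      Complex.natCast_re, div_eq_inv_mul]
  · rw [smul_kronecker, one_kronecker_one, ← smul_sub]
    exact (one_sub_choiProj_posSemidef K).smul hc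
  · rw [trA_smul]
    exact posSemidef_one_sub_inv_smul (isHermitian_trA_choiProj K) h0
  · rw [smul_kronecker, one_kronecker_one, ← smul_sub, Matrix.mul_smul, Matrix.mul_sub,
      choiProj_mul_self, Matrix.mul_one, sub_self, smul_zero, trace_zero]

theorem IsNCBipartiteGraph.div_opNorm_le_packing [Nonempty A] (hK : IsNCBipartiteGraph K) :
    (Fintype.card A : ℝ) / opNorm (trA (choiProj K)) ≤ packing K := by
  have h0 := hK.opNorm_pos
  have hc : (0 : ℂ) ≤ ((opNorm (trA (choiProj K)))⁻¹ : ℂ) := by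
    rw [← Complex.ofReal_inv]
    exact_mod_cast inv_nonneg.2 h0.le
  have h := hK.trace_re_le_packing (S := ((opNorm (trA (choiProj K)))⁻¹ : ℂ) • 1)
    ⟨PosSemidef.one.smul hc, ?_⟩
  · convert h using 1
    rw [trace_smul, trace_one, smul_eq_mul, ← Complex.ofReal_inv, Complex.re_ofReal_mul,
      Complex.natCast_re, div_eq_inv_mul]
  · rw [smul_kronecker, one_kronecker_one, Matrix.mul_smul, Matrix.mul_one, trA_smul]
    exact posSemidef_one_sub_inv_smul (isHermitian_trA_choiProj K) h0

theorem trA_one_sub_choiProj (K : Submodule ℂ (Matrix B A ℂ)) :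
    trA (1 - choiProj K) = (Fintype.card A : ℂ) • 1 - trA (choiProj K) := by
  rw [trA_sub, trA_one]

/-- Writing `M = Yᴴ Y` with `Y` invertible, an upper bound `c 𝟙` on `(Y⁻¹)ᴴ Y⁻¹` conjugated by `Y`
becomes `𝟙 ≤ c M`. -/
theorem exists_posSemidef_smul_sub_one {M : Matrix B B ℂ} (hM : M.PosDef) :
    ∃ C : ℝ, 1 ≤ C ∧ ((C : ℂ) • M - 1).PosSemidef := by
  obtain ⟨Y, hY⟩ := hM.posSemidef.exists_eq_conjTranspose_mul_self
  have hdet : IsUnit Y.det := by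
    have := (isUnit_iff_isUnit_det _).1 hM.isUnit
    rw [hY, det_mul] at this
    exact isUnit_of_mul_isUnit_right this
  obtain ⟨c, hc, h, -⟩ := exists_posSemidef_smul_one_sub_add
    (posSemidef_conjTranspose_mul_self Y⁻¹).isHermitian
  refine ⟨c + 1, by linarith, ?_⟩
  have h1 := (h.conjTranspose_mul_mul_same Y).add hM.posSemidef
  have h2 : Yᴴ * ((Y⁻¹)ᴴ * Y⁻¹) * Y = 1 := by
    rw [← Matrix.mul_assoc, ← conjTranspose_mul, Matrix.mul_assoc, nonsing_inv_mul _ hdet,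
      conjTranspose_one, Matrix.mul_one]
  rw [Matrix.mul_sub, Matrix.sub_mul, h2, Matrix.mul_smul, Matrix.mul_one, Matrix.smul_mul,
    ← hY] at h1
  have h3 : (((c + 1 : ℝ) : ℂ)) • M - 1 = (c : ℂ) • M - 1 + M := by
    push_cast
    module
  rwa [h3]

theorem IsNCBipartiteGraph.one_lt_div_opNorm [Nonempty A] (hK : IsNCBipartiteGraph K)
    (h : (trA (1 - choiProj K)).PosDef) :
    1 < (Fintype.card A : ℝ) / opNorm (trA (choiProj K)) := by
  rw [one_lt_div hK.opNorm_pos]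
  obtain ⟨C, hC, h1⟩ := exists_posSemidef_smul_sub_one h
  have hC0 : 0 < C := zero_lt_one.trans_le hC
  have hC1 : C⁻¹ ≤ 1 := inv_le_one_of_one_le₀ hC
  have hA : (1 : ℝ) ≤ Fintype.card A := by exact_mod_cast Fintype.card_pos (α := A)
  -- Dividing `𝟙 ≤ C tr_A (𝟙 - P)` by `C` gives the gap `P_B ≤ (d_A - 1/C) 𝟙`; `C ≥ 1` ensures that
  -- this bound is nonnegative.
  have h2 : (((Fintype.card A - C⁻¹ : ℝ) : ℂ) • 1 - trA (choiProj K)).PosSemidef := by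
    have hC' : (0 : ℂ) ≤ ((C⁻¹ : ℝ) : ℂ) := by exact_mod_cast (inv_pos.2 hC0).le
    have hCne : (C : ℂ) ≠ 0 := by exact_mod_cast hC0.ne'
    have h3 := h1.smul hC'
    rw [smul_sub, Complex.ofReal_inv, inv_smul_smul₀ hCne, trA_one_sub_choiProj] at h3
    convert h3 using 1
    push_cast
    module
  have h3 := opNorm_le_of_posSemidef (trA_posSemidef (choiProj_posSemidef K)) (by linarith) h2
  linarith [inv_pos.2 hC0]

theorem IsNCBipartiteGraph.logb_upsilonHat_le_capacity [Nonempty A] (hK : IsNCBipartiteGraph K) :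
    Real.logb 2 (upsilonHat K) ≤ capacity K := by
  rcases hK.one_le_upsilonHat.eq_or_lt with h1 | h1
  · rw [← h1, Real.logb_one]
    exact hK.capacity_nonneg
  have hQ : IsUnit (trA (1 - choiProj K)) := by
    by_contra hQ
    exact (upsilonHat_le_one_of_not_posDef fun h => hQ h.isUnit).not_gt h1
  -- Attainment of the maximum is not needed: a feasible pair with value above both 1 and `2 ^
  -- capacity` already gives a contradiction.
  by_contra hlt
  rw [not_le, ← Real.rpow_lt_rpow_left_iff one_lt_two, Real.rpow_logb two_pos (by norm_num)
    (zero_lt_one.trans h1)] at hlt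
  have hmax := max_lt h1 hlt
  rw [upsilonHat_eq_sSup] at hmax
  obtain ⟨_, ⟨S, U, hf, rfl⟩, ht⟩ := exists_lt_of_lt_csSup (by
    obtain ⟨S, U, h, h1⟩ := exists_feasible_trace_eq_one (choiProj K)
    exact ⟨1, S, U, h.hatFeasible, h1⟩) hmax
  have h2 := hK.logb_trace_le_capacity hQ hf ((le_max_left _ _).trans_lt ht)
  have h3 := (le_max_right _ _).trans_lt ht
  rw [Real.logb_le_iff_le_rpow one_lt_two ((zero_lt_one.trans_le (le_max_left _ _)).trans ht)] at h2
  exact h2.not_gt h3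

end LowerBounds

/-! ### Choi projections of cq-graphs. -/

section CQGraph

variable {M B : Type*} [Fintype M] [DecidableEq M] [Fintype B] [DecidableEq B]

/-- The block-diagonal operator `∑ m, |m⟩⟨m| ⊗ R m`. -/
def cqBlock (R : M → Matrix B B ℂ) : Matrix (M × B) (M × B) ℂ :=
  Matrix.of fun x y => if x.1 = y.1 then R x.1 x.2 y.2 else 0

/-- The Choi projection of a cq-graph is block diagonal. -/
theorem choiProj_cqGraph {V : M → Submodule ℂ (B → ℂ)} {R : M → Matrix B B ℂ}
    (hR : ∀ m, (R m).IsHermitian) (hfix : ∀ m, ∀ v ∈ V m, R m *ᵥ v = v)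
    (hcol : ∀ m b, (R m).col b ∈ V m) : choiProj (cqGraph V) = cqBlock R := by
  refine choiProj_eq ?_ (fun F hF => ?_) fun y => ?_
  · ext x y
    by_cases h : x.1 = y.1
    · simpa [cqBlock, h] using congrFun (congrFun (hR y.1).eq x.2) y.2
    · simp [cqBlock, h, Ne.symm h]
  · induction hF using Submodule.span_induction with
    | mem F hF =>
      obtain ⟨m, v, hv, rfl⟩ := hF
      ext x
      have h1 := congrFun (hfix m v hv) x.2
      simp only [mulVec, dotProduct] at h1
      by_cases h : x.1 = m
      · simp [mulVec, dotProduct, cqBlock, Fintype.sum_prod_type, vec, vecMulVec_apply,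
          Pi.single_apply, h, ← h1]
      · simp [mulVec, dotProduct, cqBlock, Fintype.sum_prod_type, vec, vecMulVec_apply,
          Pi.single_apply, h]
    | zero => simp
    | add F G _ _ hF hG => rw [vec_add, mulVec_add, hF, hG]
    | smul c F _ hF => rw [vec_smul, mulVec_smul, hF]
  · refine ⟨_, Submodule.subset_span ⟨y.1, _, hcol y.1 y.2, rfl⟩, ?_⟩
    ext x
    by_cases h : x.1 = y.1 <;> simp [cqBlock, vec, vecMulVec_apply, h]

theorem trA_cqBlock_mul_kronecker (R : M → Matrix B B ℂ) (S : Matrix M M ℂ) :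
    trA (cqBlock R * (S ⊗ₖ (1 : Matrix B B ℂ))) = ∑ m, S m m • R m := by
  ext b b'
  simp [trA, mul_apply, cqBlock, Fintype.sum_prod_type, Matrix.sum_apply, one_apply, mul_comm]

end CQGraph

/-! ### Generalized Pauli matrices and their twirl. -/

section Pauli

variable {d : ℕ} [NeZero d]

/-- The `d`-th root of unity `exp (2πi / d)`. -/
def pauliRoot (d : ℕ) : ℂ := Complex.exp (2 * Real.pi * Complex.I / d)

theorem isPrimitiveRoot_pauliRoot : IsPrimitiveRoot (pauliRoot d) d :=
  Complex.isPrimitiveRoot_exp d (NeZero.ne d)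

theorem star_pauliRoot : star (pauliRoot d) = (pauliRoot d)⁻¹ :=
  (Complex.inv_eq_conj (isPrimitiveRoot_pauliRoot.norm'_eq_one (NeZero.ne d))).symm

theorem pauli_apply (m : Fin d × Fin d) (a' a : Fin d) :
    pauli d m a' a = if a' = a + m.1 then pauliRoot d ^ ((m.2 : ℕ) * (a : ℕ)) else 0 := by
  rw [pauli, of_apply, pauliRoot, ← Complex.exp_nat_mul]
  congr 2
  push_cast
  ring

/-- Orthogonality of characters: for `a ≠ c` this is a full geometric sum over a `d`-th root of
unity different from 1. -/
theorem sum_pauliRoot_pow (a c : Fin d) :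
    ∑ k : Fin d, pauliRoot d ^ ((k : ℕ) * (a : ℕ)) * star (pauliRoot d ^ ((k : ℕ) * (c : ℕ))) =
      if a = c then (d : ℂ) else 0 := by
  have hζ := isPrimitiveRoot_pauliRoot (d := d)
  have hζ0 : pauliRoot d ≠ 0 := Complex.exp_ne_zero _
  set w := pauliRoot d ^ (a : ℕ) * (pauliRoot d ^ (c : ℕ))⁻¹ with hw
  have h1 : ∀ k : Fin d, pauliRoot d ^ ((k : ℕ) * (a : ℕ)) *
      star (pauliRoot d ^ ((k : ℕ) * (c : ℕ))) = w ^ (k : ℕ) := by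
    intro k
    rw [star_pow, star_pauliRoot, hw, mul_pow, mul_comm (k : ℕ), mul_comm (k : ℕ), pow_mul, pow_mul,
      inv_pow]
  simp_rw [h1]
  rw [Fin.sum_univ_eq_sum_range (fun k => w ^ k)]
  split_ifs with hac
  · have : w = 1 := by rw [hw, hac, mul_inv_cancel₀ (pow_ne_zero _ hζ0)]
    simp [this]
  · have hw1 : w ≠ 1 := by
      intro h
      rw [hw, mul_inv_eq_one₀ (pow_ne_zero _ hζ0)] at h
      exact hac (Fin.ext (hζ.pow_inj a.2 c.2 h))
    have hwd : w ^ d = 1 := by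
      rw [hw, mul_pow, inv_pow, ← pow_mul, ← pow_mul, mul_comm _ d, mul_comm _ d, pow_mul, pow_mul,
        hζ.pow_eq_one]
      simp
    rw [geom_sum_eq hw1, hwd, sub_self, zero_div]

theorem pauli_conjTranspose_mul_self (m : Fin d × Fin d) : (pauli d m)ᴴ * pauli d m = 1 := by
  have hζ0 : pauliRoot d ≠ 0 := Complex.exp_ne_zero _
  ext a c
  simp only [mul_apply, conjTranspose_apply, pauli_apply, mul_ite, mul_zero, Finset.sum_ite_eq',
    Finset.mem_univ, if_true, add_left_inj, one_apply, apply_ite star, star_zero, ite_mul,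
    zero_mul, eq_comm (a := c)]
  split_ifs with h
  · rw [h, star_pow, star_pauliRoot, inv_pow, inv_mul_cancel₀ (pow_ne_zero _ hζ0)]
  · rfl

theorem pauli_conj_apply (X : Matrix (Fin d) (Fin d) ℂ) (m : Fin d × Fin d) (a c : Fin d) :
    (pauli d m * X * (pauli d m)ᴴ) a c = X (a - m.1) (c - m.1) *
      (pauliRoot d ^ ((m.2 : ℕ) * ((a - m.1 : Fin d) : ℕ)) *
        star (pauliRoot d ^ ((m.2 : ℕ) * ((c - m.1 : Fin d) : ℕ)))) := by
  have h : ∀ a' x : Fin d, (a' = x + m.1) = (x = a' - m.1) := fun a' x =>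
    propext (eq_comm.trans eq_sub_iff_add_eq.symm)
  simp only [mul_apply, conjTranspose_apply, pauli_apply, h, apply_ite star, star_zero, mul_ite,
    mul_zero, ite_mul, zero_mul, Finset.sum_ite_eq', Finset.mem_univ, if_true]
  ring

/-- The Pauli twirl. -/
theorem sum_pauli_conj (X : Matrix (Fin d) (Fin d) ℂ) :
    ∑ m, pauli d m * X * (pauli d m)ᴴ = ((d : ℂ) * X.trace) • 1 := by
  ext a c
  -- The sum over phases kills the off-diagonal entries; the sum over shifts then turns each
  -- diagonal entry into the trace.
  simp only [Matrix.sum_apply, pauli_conj_apply, Fintype.sum_prod_type, ← Finset.mul_sum,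
    sum_pauliRoot_pow, sub_left_inj, Matrix.smul_apply, one_apply, smul_eq_mul]
  split_ifs with h
  · rw [h, ← Finset.sum_mul, mul_one, mul_comm]
    congr 1
    exact Equiv.sum_comp (Equiv.subLeft c) fun x => X x x
  · simp

end Pauli

/-! ### The packing number of the superdense coding graph. -/

section Superdense

variable {d : ℕ} [NeZero d] {B : Type*} [Fintype B] [DecidableEq B]

/-- The Pauli matrix `U_m` acting on the first factor of `A ⊗ B`. -/
def pauliLeft (B : Type*) [DecidableEq B] (m : Fin d × Fin d) :
    Matrix (Fin d × B) (Fin d × B) ℂ :=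
  pauli d m ⊗ₖ (1 : Matrix B B ℂ)

theorem pauliLeft_conjTranspose_mul_self (m : Fin d × Fin d) :
    (pauliLeft B m)ᴴ * pauliLeft B m = 1 := by
  rw [pauliLeft, conjTranspose_kronecker, ← mul_kronecker_mul, pauli_conjTranspose_mul_self,
    conjTranspose_one, Matrix.one_mul, one_kronecker_one]

theorem choiProj_superdenseGraph (K : Submodule ℂ (Matrix B (Fin d) ℂ)) :
    choiProj (superdenseGraph K) =
      cqBlock fun m => pauliLeft B m * choiProj K * (pauliLeft B m)ᴴ := by
  refine choiProj_cqGraph (fun m => ?_) (fun m v hv => ?_) fun m b => ?_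
  · exact isHermitian_mul_mul_conjTranspose _ (choiProj_isHermitian K)
  · induction hv using Submodule.span_induction with
    | mem v hv =>
      obtain ⟨E, hE, rfl⟩ := hv
      change (_ * _ * _) *ᵥ (pauliLeft B m *ᵥ E.vec) = pauliLeft B m *ᵥ E.vec
      rw [mulVec_mulVec, Matrix.mul_assoc, pauliLeft_conjTranspose_mul_self, Matrix.mul_one,
        ← mulVec_mulVec, choiProj_mulVec_vec hE]
    | zero => simp
    | add v w _ _ hv hw => rw [mulVec_add, hv, hw]
    | smul c v _ hv => rw [mulVec_smul, hv]
  · obtain ⟨E, hE, h⟩ := exists_mem_vec_eq_choiProj_mulVec K ((pauliLeft B m)ᴴ.col b)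
    refine Submodule.subset_span ⟨E, hE, ?_⟩
    change _ = pauliLeft B m *ᵥ E.vec
    rw [h, mulVec_mulVec, ← mulVec_single_one, ← mulVec_single_one, mulVec_mulVec]

theorem trA_pauliLeft_conj (X : Matrix (Fin d × B) (Fin d × B) ℂ) (m : Fin d × Fin d) :
    trA (pauliLeft B m * X * (pauliLeft B m)ᴴ) = trA X := by
  rw [pauliLeft, conjTranspose_kronecker, conjTranspose_one, trA_kronecker_one_mul_comm,
    ← Matrix.mul_assoc, ← mul_kronecker_mul, pauli_conjTranspose_mul_self, Matrix.one_mul,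
    one_kronecker_one, Matrix.one_mul]

theorem sum_pauliLeft_conj (X : Matrix (Fin d × B) (Fin d × B) ℂ) :
    ∑ m, pauliLeft B m * X * (pauliLeft B m)ᴴ =
      (d : ℂ) • ((1 : Matrix (Fin d) (Fin d) ℂ) ⊗ₖ trA X) := by
  ext x y
  have h : ∀ m, (pauliLeft B m * X * (pauliLeft B m)ᴴ) x y =
      (pauli d m * (X.submatrix (fun a => (a, x.2)) fun a => (a, y.2)) * (pauli d m)ᴴ) x.1 y.1 := by
    intro m
    simp [pauliLeft, mul_apply, Fintype.sum_prod_type, one_apply, apply_ite (starRingEnd ℂ)]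
  have h2 := congrFun (congrFun
    (sum_pauli_conj (X.submatrix (fun a => (a, x.2)) fun a => (a, y.2))) x.1) y.1
  rw [Matrix.sum_apply] at h2 ⊢
  simp_rw [h]
  rw [h2]
  simp [trA, trace, mul_comm, mul_left_comm]

/-- The Choi projection is block diagonal, so the constraint only sees the diagonal of `S` and reads
`∑ m, S m m • U_m P U_mᴴ ≤ 𝟙`. Tracing out `A` bounds `tr S`, and uniform weights attain the bound
by the twirl. -/
theorem packing_superdenseGraph {K : Submodule ℂ (Matrix B (Fin d) ℂ)}
    (hK : IsNCBipartiteGraph K) :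
    packing (superdenseGraph K) = (d : ℝ) / opNorm (trA (choiProj K)) := by
  have h0 := hK.opNorm_pos
  set N := opNorm (trA (choiProj K)) with hN
  have hd : (0 : ℝ) < d := by exact_mod_cast Nat.pos_of_ne_zero (NeZero.ne d)
  have hdC : (d : ℂ) ≠ 0 := by exact_mod_cast hd.ne'
  rw [packing_eq_sSup, choiProj_superdenseGraph]
  -- The weight `1 / (d N)` on each of the `d²` inputs has total `d / N`, and the twirl turns the
  -- constraint into `𝟙 ⊗ P_B / N ≤ 𝟙`.
  refine IsGreatest.csSup_eq ⟨⟨(((d * N)⁻¹ : ℝ) : ℂ) • 1, ⟨?_, ?_⟩, ?_⟩, ?_⟩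
  · exact PosSemidef.one.smul (by exact_mod_cast (inv_pos.2 (mul_pos hd h0)).le)
  · rw [trA_cqBlock_mul_kronecker]
    have h1 := (PosSemidef.one (n := Fin d) (R := ℂ)).kronecker
      (posSemidef_one_sub_inv_smul (isHermitian_trA_choiProj K) h0)
    have h2 : (1 : Matrix (Fin d × B) (Fin d × B) ℂ) - ∑ m, ((((d * N)⁻¹ : ℝ) : ℂ) •
        (1 : Matrix (Fin d × Fin d) (Fin d × Fin d) ℂ)) m m •
          (pauliLeft B m * choiProj K * (pauliLeft B m)ᴴ) =
        (1 : Matrix (Fin d) (Fin d) ℂ) ⊗ₖ (1 - ((N : ℂ)⁻¹) • trA (choiProj K)) := by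
      simp only [Matrix.smul_apply, one_apply_eq, smul_eq_mul, mul_one]
      rw [← Finset.smul_sum, sum_pauliLeft_conj, smul_smul, ← one_kronecker_one]
      have : (((d * N)⁻¹ : ℝ) : ℂ) * d = (N : ℂ)⁻¹ := by
        push_cast
        field_simp
      rw [this]
      ext
      simp [mul_sub, mul_left_comm, -kroneckerMap_one_one]
    rw [h2]
    exact h1
  · rw [trace_smul, trace_one, smul_eq_mul, Complex.re_ofReal_mul, Complex.natCast_re,
      Fintype.card_prod, Fintype.card_fin]
    push_cast
    field_simp
  · rintro _ ⟨S, hS, rfl⟩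
    have hs0 : (0 : ℝ) ≤ S.trace.re := (Complex.le_def.1 hS.nonneg.trace_nonneg).1
    rw [le_div_iff₀ h0]
    -- Conjugation by `U_m` on `A` does not change the partial trace, so tracing out `A` leaves `(tr
    -- S) P_B ≤ d 𝟙`.
    have h1 := trA_posSemidef hS.trA_le
    rw [trA_sub, trA_one, trA_cqBlock_mul_kronecker, Fintype.card_fin] at h1
    have h2 : trA (∑ m, S m m • (pauliLeft B m * choiProj K * (pauliLeft B m)ᴴ)) =
        (S.trace.re : ℂ) • trA (choiProj K) := by
      have h3 : ∀ f : Fin d × Fin d → Matrix (Fin d × B) (Fin d × B) ℂ,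
          trA (∑ m, f m) = ∑ m, trA (f m) := fun f => by
        ext
        simp only [trA, of_apply, Matrix.sum_apply]
        exact Finset.sum_comm
      rw [h3, hS.nonneg.isHermitian.coe_re_trace, trace, Finset.sum_smul]
      simp only [trA_smul, trA_pauliLeft_conj, diag]
    rw [h2] at h1
    have h4 : ((S.trace.re : ℂ) • trA (choiProj K)).PosSemidef :=
      (trA_posSemidef (choiProj_posSemidef K)).smul (by exact_mod_cast hs0)
    have h5 := opNorm_le_of_posSemidef h4 hd.le (by exact_mod_cast h1)
    have h6 : opNorm ((S.trace.re : ℂ) • trA (choiProj K)) = S.trace.re * N := by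
      rw [hN, opNorm, map_smul, norm_smul, Complex.norm_real, Real.norm_of_nonneg hs0, opNorm]
    rwa [h6] at h5

end Superdense

end NoSignalling

end

open NoSignalling in
theorem mainTheorem10 (dA dB : ℕ) [NeZero dA]
    (K : Submodule ℂ (Matrix (Fin dB) (Fin dA) ℂ)) (hK : IsNCBipartiteGraph K) :
    List.TFAE [
      0 < capacity K,
      1 < packing K,
      ((dA : ℂ) • (1 : Matrix (Fin dB) (Fin dB) ℂ) - trA (choiProj K)).PosDef,
      (trA (1 - choiProj K)).PosDef,
      1 < upsilonHat K] ∧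
    Real.logb 2 (upsilonHat K) ≤ capacity K ∧
    (dA : ℝ) / opNorm (trA (choiProj K)) ≤ upsilonHat K ∧
    Real.logb 2 ((dA : ℝ) / opNorm (trA (choiProj K))) ≤ Real.logb 2 (upsilonHat K) ∧
    (dA : ℝ) / opNorm (trA (choiProj K)) ≤ packing K ∧
    packing (superdenseGraph K) = (dA : ℝ) / opNorm (trA (choiProj K)) := by
  have hdA : (0 : ℝ) < dA := by exact_mod_cast Nat.pos_of_ne_zero (NeZero.ne dA)
  have hcap := hK.logb_upsilonHat_le_capacity
  have hhat := hK.div_opNorm_le_upsilonHat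
  have hpack := hK.div_opNorm_le_packing
  have hone := hK.one_lt_div_opNorm
  have htr := trA_one_sub_choiProj K
  rw [Fintype.card_fin] at hhat hpack hone htr
  refine ⟨?_, hcap, hhat, Real.logb_le_logb_of_le one_lt_two (div_pos hdA hK.opNorm_pos) hhat,
    hpack, packing_superdenseGraph hK⟩
  -- This makes (iii) and (iv) the same statement.
  rw [← htr]
  tfae_have 1 → 3 := fun h => by
    by_contra hn
    exact (hK.capacity_nonpos_of_not_posDef hn).not_gt h
  tfae_have 2 → 3 := fun h => by
    by_contra hn
    exact (packing_le_one_of_not_posDef hn).not_gt h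
  tfae_have 3 → 2 := fun h => (hone h).trans_le hpack
  tfae_have 3 ↔ 4 := Iff.rfl
  tfae_have 3 → 5 := fun h => (hone h).trans_le hhat
  tfae_have 5 → 1 := fun h => (Real.logb_pos one_lt_two h).trans_le hcap
  tfae_finish
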